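/- Let $f,g:\mathbb R^n\to[0,\infty)$ be probability densities with finite second moments, $\int |x|^2 f(x)\,dx<\infty$ and $\int |y|^2 g(y)\,dy<\infty$. Call a measure $\nu$ on $\mathbb R^n\times\mathbb R^n$ a transport plan if its marginals are $f(x)\,dx$ and $g(y)\,dy$, and call it optimal if it minimizes $\int \frac12|x-y|^2\,d\nu(x,y)$ among all transport plans. Then there is exactly one optimal transport plan $\nu_0$, and there are an open convex set $\Omega\subset\mathbb R^n$ with $\int_{\mathbb R^n\setminus\Omega} f\,dx=0$ and a convex function $\varphi:\Omega\to\mathbb R$, differentiable almost everywhere in $\Omega$, such that: (i) $\nu_0$ is concentrated on the graph of $Y=\nabla\varphi$: it is the image of $f(x)\,dx$ under $x\mapsto(x,\nabla\varphi(x))$; in particular $\nabla\varphi$ pushes $f(x)\,dx$ forward to $g(y)\,dy$; (ii) $\nabla\varphi$ is one-to-one on a set of full $f(x)\,dx$-measure; (iii) $\varphi$ satisfies the Monge–Ampère equation $g(\nabla\varphi(x))\,\det D^2\varphi(x)=f(x)$ at almost every $x\in\Omega$, where $D^2\varphi(x)$ is the derivative at $x$ of the map $\nabla\varphi$, taken along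 the points at which $\varphi$ is differentiable (it exists at almost every $x\in\Omega$). -/

import Mathlib

open MeasureTheory

noncomputable section

namespace OptimalTransport

/-- The Euclidean space of dimension `n`. -/
abbrev Euc (n : ℕ) : Type := EuclideanSpace ℝ (Fin n)

/-- `f` is a probability density with finite second moment. -/
structure IsDensity {n : ℕ} (f : Euc n → ℝ) : Prop where
  nonneg : ∀ x, 0 ≤ f x
  integrable : Integrable f volume
  integral_eq_one : ∫ x, f x = 1
  secondMoment : Integrable (fun x => ‖x‖ ^ 2 * f x) volume

/-- The measure `f(x) dx`. -/
def densityMeasure {n : ℕ} (f : Euc n → ℝ) : Measure (Euc n) :=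
  volume.withDensity (fun x => ENNReal.ofReal (f x))

/-- `ν` is a transport plan (coupling): a joint law with marginals `f(x) dx` and `g(y) dy`. -/
structure IsPlan {n : ℕ} (f g : Euc n → ℝ) (ν : Measure (Euc n × Euc n)) : Prop where
  fst_eq : ν.map Prod.fst = densityMeasure f
  snd_eq : ν.map Prod.snd = densityMeasure g

/-- The quadratic cost `∫ ½ |x - y|² dν(x, y)`, with values in `[0, ∞]`. -/
def cost {n : ℕ} (ν : Measure (Euc n × Euc n)) : ENNReal :=
  ∫⁻ p, ENNReal.ofReal ((1 / 2) * ‖p.1 - p.2‖ ^ 2) ∂ν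

/-- `ν` is an optimal transport plan between `f(x) dx` and `g(y) dy`. -/
structure IsOptimalPlan {n : ℕ} (f g : Euc n → ℝ) (ν : Measure (Euc n × Euc n)) : Prop where
  isPlan : IsPlan f g ν
  cost_le : ∀ ν' : Measure (Euc n × Euc n), IsPlan f g ν' → cost ν ≤ cost ν'

/-- `A` is the Hessian `D²φ(x)`: `φ` is differentiable at `x`, and `A` is the derivative at `x`
of the gradient map of `φ`, the latter being defined only where `φ` is differentiable.
(For a convex `φ` the gradient is defined almost everywhere near `x`, but not everywhere.) -/
def HasHessianAt {n : ℕ} (φ : Euc n → ℝ) (A : Euc n →L[ℝ] Euc n) (x : Euc n) : Prop :=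
  DifferentiableAt ℝ φ x ∧
    HasFDerivWithinAt (gradient φ) A {z | DifferentiableAt ℝ φ z} x

end OptimalTransport

end

/-!
The proof goes through the dual problem. Since the second moments are fixed, minimizing
`∫ ½ |x - y|² dπ` over couplings means maximizing `∫ ⟪x, y⟫ dπ`, and this is bounded above by
`∫ u f + ∫ v g` whenever `⟪x, y⟫ ≤ u x + v y`.

*Dual minimizers.* After adding `½ |x|²` and `½ |y|²` the constraint reads `½ |x + y|² ≤ α x + β y`,
and since the kernel is nonnegative one may take `α, β ≥ 0`. Among the almost minimizers of the
dual functional choose almost minimizers of the strictly convex functional `∫ e^{-α} + ∫ e^{-β}`. The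
identity `½ a² + ½ b² - a b = ½ (a - b)²` for `a = e^{-α/2}`, `b = e^{-α'/2}` shows that these
exponentials are Cauchy in `L²`, so a subsequence converges almost everywhere, and Fatou's lemma
makes the limit a minimizer (`exists_dual_minimizer`). No regularity of `α`, `β` enters.

*The map.* Let `ψ` be the minimizer on the `y` side, `φ` its Legendre transform and `Ω` the interior
of the domain of `φ`. Replacing `ψ` by `ψ + t h` changes `φ` to first order by `-t h(∇φ)`
(`tendsto_slope_legendre`), because almost maximizers in the Legendre transform are approximate
subgradients, and these are close to `∇φ` at points of differentiability. Minimality therefore gives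
`∫ h(∇φ) f = ∫ h g` for all bounded continuous `h` (`exists_potential`). The graph of `∇φ` attains
equality in Young's inequality `⟪x, y⟫ ≤ φ x + φ* y`, so its coupling is optimal; any other optimal
coupling attains equality almost everywhere too, which forces `y = ∇φ x`.

*The Hessian.* The resolvent `J = (id + ∂φ)⁻¹` is nonexpansive. Rademacher's theorem and Sard's lemma
for `J` show that for almost every `x` the subgradient map of `φ` is differentiable at `x`, with
derivative `A = J'⁻¹ - id` (`ae_hasSubgradientDerivAt`). If `det A ≠ 0` at `x`, then `∇φ x` is a
subgradient at no other point, so `∇φ` is injective on the set where `det A ≠ 0`, and the change of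
variables formula gives the Monge–Ampère equation there. The set where `det A = 0` has a null image
and is therefore not charged by `f(x) dx`, so both sides of the equation vanish on it
(`monge_ampere`).
-/

namespace OptimalTransport

open Filter Topology Set
open scoped ENNReal RealInnerProductSpace BoundedContinuousFunction

/-! ### Attainment in the dual problem -/

section Dual

variable {X Y : Type*} [MeasurableSpace X] [MeasurableSpace Y]

/-- Feasibility of a pair of integrable functions `(α, β)` in the dual problem with kernel `c`:
the constraint `c x y ≤ α x + β y` is imposed only for `x`, `y` in sets of full measure, which
makes it stable under almost everywhere limits. -/
structure IsDualFeasible (μ : Measure X) (ν : Measure Y) (c : X → Y → ℝ) (α : X → ℝ)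
    (β : Y → ℝ) : Prop where
  integrable_left : Integrable α μ
  integrable_right : Integrable β ν
  le_add : ∃ s ∈ ae μ, ∃ t ∈ ae ν, ∀ x ∈ s, ∀ y ∈ t, c x y ≤ α x + β y

/-- Since `c ≥ 0`, moving a constant from one function to the other makes both nonnegative. -/
theorem IsDualFeasible.exists_nonneg {μ : Measure X} {ν : Measure Y} [IsProbabilityMeasure μ]
    [IsProbabilityMeasure ν] {c : X → Y → ℝ} (hc : ∀ x y, 0 ≤ c x y) {α : X → ℝ} {β : Y → ℝ}
    (h : IsDualFeasible μ ν c α β) :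
    ∃ α' β', IsDualFeasible μ ν c α' β' ∧ 0 ≤ᵐ[μ] α' ∧ 0 ≤ᵐ[ν] β' ∧
      ∫ x, α' x ∂μ + ∫ y, β' y ∂ν = ∫ x, α x ∂μ + ∫ y, β y ∂ν := by
  obtain ⟨s, hs, t, ht, hst⟩ := h.le_add
  obtain ⟨x₀, hx₀⟩ := Filter.nonempty_of_mem hs
  obtain ⟨y₀, hy₀⟩ := Filter.nonempty_of_mem ht
  have hbdd : BddBelow (α '' s) := by
    refine ⟨-β y₀, ?_⟩
    rintro _ ⟨x, hx, rfl⟩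
    linarith [hst x hx y₀ hy₀, hc x y₀]
  set m := sInf (α '' s) with hm
  refine ⟨fun x => α x - m, fun y => β y + m,
    ⟨h.integrable_left.sub (integrable_const m), h.integrable_right.add (integrable_const m),
      s, hs, t, ht, fun x hx y hy => by linarith [hst x hx y hy]⟩, ?_, ?_, ?_⟩
  · filter_upwards [hs] with x hx
    have : m ≤ α x := csInf_le hbdd ⟨x, hx, rfl⟩
    simpa using this
  · filter_upwards [ht] with y hy
    have : -β y ≤ m := by
      refine le_csInf ⟨_, x₀, hx₀, rfl⟩ ?_
      rintro _ ⟨x, hx, rfl⟩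
      linarith [hst x hx y hy, hc x y]
    simp only [Pi.zero_apply]
    linarith
  · rw [integral_sub h.integrable_left (integrable_const m),
      integral_add h.integrable_right (integrable_const m)]
    simp

/-- A minimizing sequence for `J` along which a second functional `F` is asymptotically midpoint
affine: `h k` almost minimizes `F` among the points where `J` is within `1 / (k + 1)` of its
infimum, and midpoints of two such points cannot have a much smaller value of `F`. -/
theorem exists_minimizing_seq {H : Type*} {K : Set H} (hK : K.Nonempty) {J F : H → ℝ}
    {mid : H → H → H} {C : ℝ} (hJ : ∀ h ∈ K, 0 ≤ J h) (hF : ∀ h ∈ K, 0 ≤ F h)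
    (hFC : ∀ h ∈ K, F h ≤ C) (hmid : ∀ a ∈ K, ∀ b ∈ K, mid a b ∈ K)
    (hJmid : ∀ a ∈ K, ∀ b ∈ K, J (mid a b) ≤ max (J a) (J b)) :
    ∃ h : ℕ → H, (∀ k, h k ∈ K) ∧ Tendsto (fun k => J (h k)) atTop (𝓝 (sInf (J '' K))) ∧
      ∀ ε > 0, ∃ N, ∀ j ≥ N, ∀ k ≥ N, F (h j) + F (h k) - 2 * F (mid (h j) (h k)) ≤ ε := by
  set m := sInf (J '' K) with hm
  have hJb : BddBelow (J '' K) := ⟨0, by rintro _ ⟨h, hh, rfl⟩; exact hJ h hh⟩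
  set L : ℕ → Set H := fun k => {h | h ∈ K ∧ J h ≤ m + 1 / ((k : ℝ) + 1)} with hL
  have hpos : ∀ k : ℕ, (0 : ℝ) < 1 / ((k : ℝ) + 1) := fun k => Nat.one_div_pos_of_nat
  have hLne : ∀ k, (L k).Nonempty := by
    intro k
    obtain ⟨_, ⟨h, hh, rfl⟩, hlt⟩ := exists_lt_of_csInf_lt (hK.image J)
      (show sInf (J '' K) < m + 1 / ((k : ℝ) + 1) by linarith [hpos k])
    exact ⟨h, hh, hlt.le⟩
  have hLanti : ∀ i j, i ≤ j → L j ⊆ L i := by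
    intro i j hij h hh
    exact ⟨hh.1, hh.2.trans (by gcongr)⟩
  have hFb : ∀ k, BddBelow (F '' L k) := fun k =>
    ⟨0, by rintro _ ⟨h, hh, rfl⟩; exact hF h hh.1⟩
  set c : ℕ → ℝ := fun k => sInf (F '' L k) with hc
  have hcmono : Monotone c := fun i j hij =>
    csInf_le_csInf (hFb i) ((hLne j).image F) (Set.image_mono (hLanti i j hij))
  have hcC : BddAbove (Set.range c) := by
    refine ⟨C, ?_⟩
    rintro _ ⟨k, rfl⟩
    obtain ⟨h, hh⟩ := hLne k
    exact (csInf_le (hFb k) ⟨h, hh, rfl⟩).trans (hFC h hh.1)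
  have hclim := tendsto_atTop_ciSup hcmono hcC
  have hex : ∀ k, ∃ h ∈ L k, F h < c k + 1 / ((k : ℝ) + 1) := by
    intro k
    obtain ⟨_, ⟨h, hh, rfl⟩, hlt⟩ := exists_lt_of_csInf_lt ((hLne k).image F)
      (show sInf (F '' L k) < c k + 1 / ((k : ℝ) + 1) by linarith [hpos k])
    exact ⟨h, hh, hlt⟩
  choose h hhL hhF using hex
  refine ⟨h, fun k => (hhL k).1, ?_, ?_⟩
  · refine tendsto_of_tendsto_of_tendsto_of_le_of_le (tendsto_const_nhds (x := m))
      (h := fun k : ℕ => m + 1 / ((k : ℝ) + 1)) ?_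
      (fun k => csInf_le hJb ⟨_, (hhL k).1, rfl⟩) (fun k => (hhL k).2)
    simpa using tendsto_const_nhds.add (tendsto_one_div_add_atTop_nhds_zero_nat (𝕜 := ℝ))
  · intro ε hε
    have h1 := (tendsto_order.1 hclim).1 ((⨆ k, c k) - ε / 4) (by linarith)
    have h2 := (tendsto_order.1 (tendsto_one_div_add_atTop_nhds_zero_nat (𝕜 := ℝ))).2 (ε / 4)
      (by linarith)
    obtain ⟨N, hN⟩ := (h1.and h2).exists_forall_of_atTop
    refine ⟨N, fun j hj k hk => ?_⟩
    have hjL := hLanti N j hj (hhL j)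
    have hkL := hLanti N k hk (hhL k)
    have hmidL : mid (h j) (h k) ∈ L N := ⟨hmid _ hjL.1 _ hkL.1,
      (hJmid _ hjL.1 _ hkL.1).trans (max_le hjL.2 hkL.2)⟩
    have h3 : c N ≤ F (mid (h j) (h k)) := csInf_le (hFb N) ⟨_, hmidL, rfl⟩
    have h4 := le_ciSup hcC j
    have h5 := le_ciSup hcC k
    linarith [hhF j, hhF k, (hN N le_rfl).1, (hN j hj).2, (hN k hk).2]

/-- A Cauchy sequence in `L²` has an almost everywhere convergent subsequence. -/
theorem exists_subseq_ae_tendsto_of_integral_sq {μ : Measure X} [IsProbabilityMeasure μ]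
    {u : ℕ → X → ℝ} (hu : ∀ k, AEStronglyMeasurable (u k) μ) (hu1 : ∀ k, ∀ᵐ x ∂μ, |u k x| ≤ 1)
    (hcau : ∀ ε > 0, ∃ N, ∀ j ≥ N, ∀ k ≥ N, ∫ x, (u j x - u k x) ^ 2 ∂μ ≤ ε) :
    ∃ ns : ℕ → ℕ, StrictMono ns ∧ ∃ l : X → ℝ,
      ∀ᵐ x ∂μ, Tendsto (fun i => u (ns i) x) atTop (𝓝 (l x)) := by
  have hLp : ∀ k, MemLp (u k) 2 μ := fun k => MemLp.of_bound (hu k) 1 (hu1 k)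
  have hcs : CauchySeq (fun k => (hLp k).toLp (u k)) := by
    rw [Metric.cauchySeq_iff]
    intro ε hε
    obtain ⟨N, hN⟩ := hcau (ε ^ 2 / 2) (by positivity)
    refine ⟨N, fun j hj k hk => ?_⟩
    have hsq : dist ((hLp j).toLp (u j)) ((hLp k).toLp (u k)) ^ 2
        = ∫ x, (u j x - u k x) ^ 2 ∂μ := by
      rw [dist_eq_norm, ← MemLp.toLp_sub, ← real_inner_self_eq_norm_sq, L2.inner_def]
      refine integral_congr_ae ?_
      filter_upwards [((hLp j).sub (hLp k)).coeFn_toLp] with x hx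
      rw [hx]
      simp [sq]
    have := hN j hj k hk
    rw [← hsq] at this
    refine lt_of_pow_lt_pow_left₀ 2 hε.le (by nlinarith)
  obtain ⟨l, hl⟩ := cauchySeq_tendsto_of_complete hcs
  obtain ⟨ns, hns, hlim⟩ := (tendstoInMeasure_of_tendsto_Lp hl).exists_seq_tendsto_ae
  refine ⟨ns, hns, l, ?_⟩
  have hco : ∀ᵐ x ∂μ, ∀ k, ((hLp k).toLp (u k)) x = u k x :=
    ae_all_iff.2 fun k => (hLp k).coeFn_toLp
  filter_upwards [hlim, hco] with x hx hcx
  simpa [hcx] using hx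

/-- Fatou's lemma excludes the value `∞` for the limit of the nonnegative functions `α k`. -/
theorem exists_ae_tendsto_of_exp {μ : Measure X} {α : ℕ → X → ℝ} {l : X → ℝ} {C : ℝ}
    (hα : ∀ k, Integrable (α k) μ) (h0 : ∀ k, 0 ≤ᵐ[μ] α k) (hC : ∀ k, ∫ x, α k x ∂μ ≤ C)
    (hl : ∀ᵐ x ∂μ, Tendsto (fun k => Real.exp (-(α k x) / 2)) atTop (𝓝 (l x))) :
    ∃ α' : X → ℝ, Integrable α' μ ∧ 0 ≤ᵐ[μ] α' ∧
      (∀ᵐ x ∂μ, Tendsto (fun k => α k x) atTop (𝓝 (α' x))) ∧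
      ENNReal.ofReal (∫ x, α' x ∂μ) ≤
        liminf (fun k => ENNReal.ofReal (∫ x, α k x ∂μ)) atTop := by
  have hmeas : ∀ k, AEMeasurable (fun x => ENNReal.ofReal (α k x)) μ := fun k =>
    (hα k).aestronglyMeasurable.aemeasurable.ennreal_ofReal
  have hfatou : ∫⁻ x, liminf (fun k => ENNReal.ofReal (α k x)) atTop ∂μ ≤
      liminf (fun k => ENNReal.ofReal (∫ x, α k x ∂μ)) atTop := by
    refine (lintegral_liminf_le' hmeas).trans_eq ?_
    congr 1
    ext k
    rw [ofReal_integral_eq_lintegral_ofReal (hα k) (h0 k)]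
  have hfin : ∫⁻ x, liminf (fun k => ENNReal.ofReal (α k x)) atTop ∂μ ≠ ∞ := by
    refine ne_top_of_le_ne_top (b := ENNReal.ofReal C) ENNReal.ofReal_ne_top (hfatou.trans ?_)
    refine (liminf_le_liminf (Eventually.of_forall fun k =>
      ENNReal.ofReal_le_ofReal (hC k))).trans_eq ?_
    simp
  have hliminf : AEMeasurable (fun x => liminf (fun k => ENNReal.ofReal (α k x)) atTop) μ := by
    simp only [liminf_eq_iSup_iInf_of_nat]
    exact AEMeasurable.iSup fun n => AEMeasurable.iInf fun i => AEMeasurable.iInf fun _ => hmeas i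
  have hae := ae_lt_top' hliminf hfin
  have hlim : ∀ᵐ x ∂μ, Tendsto (fun k => α k x) atTop (𝓝 (-2 * Real.log (l x))) := by
    filter_upwards [hl, hae] with x hx hfx
    have hl0 : l x ≠ 0 := by
      intro hl0
      rw [hl0] at hx
      have h1 : Tendsto (fun k => α k x) atTop atTop := by
        have h2 : Tendsto (fun k => -(α k x) / 2) atTop atBot := by
          rwa [← Real.tendsto_exp_comp_nhds_zero]
        have h3 := (tendsto_neg_atBot_atTop.comp h2).const_mul_atTop (zero_lt_two' ℝ)
        refine h3.congr fun k => ?_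
        simp only [Function.comp]
        ring
      have h4 := (ENNReal.tendsto_ofReal_atTop.comp h1).liminf_eq
      simp only [Function.comp_def] at h4
      rw [h4] at hfx
      exact lt_irrefl _ hfx
    have := ((Real.continuousAt_log hl0).tendsto.comp hx).const_mul (-2)
    refine this.congr fun k => ?_
    simp only [Function.comp, Real.log_exp]
    ring
  set α' : X → ℝ := fun x => -2 * Real.log (l x) with hα'
  have hα'm : AEStronglyMeasurable α' μ :=
    aestronglyMeasurable_of_tendsto_ae atTop (fun k => (hα k).aestronglyMeasurable) hlim
  have hα'0 : 0 ≤ᵐ[μ] α' := by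
    filter_upwards [hlim, ae_all_iff.2 h0] with x hx h0x
    exact ge_of_tendsto' hx h0x
  have hlinteq : ∫⁻ x, ENNReal.ofReal (α' x) ∂μ =
      ∫⁻ x, liminf (fun k => ENNReal.ofReal (α k x)) atTop ∂μ := by
    refine lintegral_congr_ae ?_
    filter_upwards [hlim] with x hx
    exact ((ENNReal.continuous_ofReal.tendsto _).comp hx).liminf_eq.symm
  have hint : Integrable α' μ := by
    refine ⟨hα'm, ?_⟩
    rw [hasFiniteIntegral_iff_ofReal hα'0, hlinteq]
    exact hfin.lt_top
  refine ⟨α', hint, hα'0, hlim, ?_⟩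
  rw [ofReal_integral_eq_lintegral_ofReal hint hα'0, hlinteq]
  exact hfatou

/-- The defect of midpoint convexity of `a ↦ ∫ e^{-a}` is the square of an `L²` distance. -/
theorem integral_sq_sub_exp {μ : Measure X} [IsFiniteMeasure μ] {a b : X → ℝ}
    (ha : Integrable a μ) (hb : Integrable b μ) (ha0 : 0 ≤ᵐ[μ] a) (hb0 : 0 ≤ᵐ[μ] b) :
    ∫ x, (Real.exp (-(a x) / 2) - Real.exp (-(b x) / 2)) ^ 2 ∂μ =
      ∫ x, Real.exp (-(a x)) ∂μ + ∫ x, Real.exp (-(b x)) ∂μ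
        - 2 * ∫ x, Real.exp (-((a x + b x) / 2)) ∂μ := by
  have key : ∀ {a : X → ℝ}, Integrable a μ → 0 ≤ᵐ[μ] a →
      Integrable (fun x => Real.exp (-(a x))) μ := by
    intro a ha ha0
    refine Integrable.of_bound (Real.continuous_exp.comp_aestronglyMeasurable
      ha.aestronglyMeasurable.neg) 1 ?_
    filter_upwards [ha0] with x hx
    rw [Real.norm_eq_abs, Real.abs_exp]
    exact Real.exp_le_one_iff.2 (neg_nonpos.2 hx)
  have hab : Integrable (fun x => Real.exp (-((a x + b x) / 2))) μ := by
    refine key ((ha.add hb).div_const 2) ?_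
    filter_upwards [ha0, hb0] with x hx hy
    simp only [Pi.zero_apply] at *
    linarith
  have hsum : Integrable (fun x => Real.exp (-(a x)) + Real.exp (-(b x))) μ :=
    (key ha ha0).add (key hb hb0)
  rw [← integral_const_mul, ← integral_add (key ha ha0) (key hb hb0),
    ← integral_sub hsum (hab.const_mul 2)]
  congr 1
  ext x
  have h1 : ∀ r : ℝ, Real.exp (-r) = Real.exp (-r / 2) ^ 2 := by
    intro r
    rw [← Real.exp_nat_mul]
    congr 1
    push_cast
    ring
  have h2 : Real.exp (-((a x + b x) / 2)) = Real.exp (-(a x) / 2) * Real.exp (-(b x) / 2) := by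
    rw [← Real.exp_add]
    congr 1
    ring
  rw [h1 (a x), h1 (b x), h2]
  ring

theorem integral_exp_neg_le_one {μ : Measure X} [IsProbabilityMeasure μ] {a : X → ℝ}
    (ha : 0 ≤ᵐ[μ] a) : ∫ x, Real.exp (-(a x)) ∂μ ≤ 1 := by
  calc ∫ x, Real.exp (-(a x)) ∂μ ≤ ∫ _, (1 : ℝ) ∂μ := by
        refine integral_mono_of_nonneg (Eventually.of_forall fun x => (Real.exp_pos _).le)
          (integrable_const _) ?_
        filter_upwards [ha] with x hx
        exact Real.exp_le_one_iff.2 (neg_nonpos.2 hx)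
    _ = 1 := by simp

theorem liminf_add_liminf_le (u v : ℕ → ℝ≥0∞) :
    liminf u atTop + liminf v atTop ≤ liminf (fun k => u k + v k) atTop := by
  have hmono : ∀ w : ℕ → ℝ≥0∞, Monotone fun n => ⨅ i ≥ n, w i := fun w m n hmn =>
    biInf_mono fun i hi => hmn.trans hi
  simp only [liminf_eq_iSup_iInf_of_nat]
  rw [ENNReal.iSup_add_iSup_of_monotone (hmono u) (hmono v)]
  exact iSup_mono fun n => le_iInf₂ fun i hi => add_le_add (iInf₂_le i hi) (iInf₂_le i hi)

/-- The dual problem with a nonnegative kernel is attained as soon as it is feasible. -/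
theorem exists_dual_minimizer {μ : Measure X} {ν : Measure Y} [IsProbabilityMeasure μ]
    [IsProbabilityMeasure ν] {c : X → Y → ℝ} (hc : ∀ x y, 0 ≤ c x y)
    (hne : ∃ α β, IsDualFeasible μ ν c α β) :
    ∃ α β, IsDualFeasible μ ν c α β ∧ ∀ α' β', IsDualFeasible μ ν c α' β' →
      ∫ x, α x ∂μ + ∫ y, β y ∂ν ≤ ∫ x, α' x ∂μ + ∫ y, β' y ∂ν := by
  set K : Set ((X → ℝ) × (Y → ℝ)) :=
    {h | IsDualFeasible μ ν c h.1 h.2 ∧ 0 ≤ᵐ[μ] h.1 ∧ 0 ≤ᵐ[ν] h.2} with hK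
  set J : (X → ℝ) × (Y → ℝ) → ℝ := fun h => ∫ x, h.1 x ∂μ + ∫ y, h.2 y ∂ν with hJ
  set F : (X → ℝ) × (Y → ℝ) → ℝ := fun h =>
    ∫ x, Real.exp (-(h.1 x)) ∂μ + ∫ y, Real.exp (-(h.2 y)) ∂ν with hF
  set mid : (X → ℝ) × (Y → ℝ) → (X → ℝ) × (Y → ℝ) → (X → ℝ) × (Y → ℝ) := fun a b =>
    (fun x => (a.1 x + b.1 x) / 2, fun y => (a.2 y + b.2 y) / 2) with hmid
  have hKne : K.Nonempty := by
    obtain ⟨α, β, h⟩ := hne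
    obtain ⟨α', β', h', h0, h1, -⟩ := h.exists_nonneg hc
    exact ⟨(α', β'), h', h0, h1⟩
  have hJ0 : ∀ h ∈ K, 0 ≤ J h := fun h hh =>
    add_nonneg (integral_nonneg_of_ae hh.2.1) (integral_nonneg_of_ae hh.2.2)
  have hF0 : ∀ h ∈ K, 0 ≤ F h := fun h _ =>
    add_nonneg (integral_nonneg fun x => (Real.exp_pos _).le)
      (integral_nonneg fun x => (Real.exp_pos _).le)
  obtain ⟨h, hhK, hhJ, hhF⟩ := exists_minimizing_seq (mid := mid) (C := 1 + 1) hKne hJ0 hF0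
    (fun h hh => add_le_add (integral_exp_neg_le_one hh.2.1) (integral_exp_neg_le_one hh.2.2))
    (by
      rintro a ⟨ha, ha1, ha2⟩ b ⟨hb, hb1, hb2⟩
      obtain ⟨s, hs, t, ht, hst⟩ := ha.le_add
      obtain ⟨s', hs', t', ht', hst'⟩ := hb.le_add
      refine ⟨⟨(ha.integrable_left.add hb.integrable_left).div_const 2,
        (ha.integrable_right.add hb.integrable_right).div_const 2, s ∩ s', inter_mem hs hs',
        t ∩ t', inter_mem ht ht', fun x hx y hy => ?_⟩, ?_, ?_⟩
      · have h1 := hst x hx.1 y hy.1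
        have h2 := hst' x hx.2 y hy.2
        simp only [hmid]
        linarith
      · filter_upwards [ha1, hb1] with x h1 h2
        simp only [Pi.zero_apply, hmid] at *
        linarith
      · filter_upwards [ha2, hb2] with x h1 h2
        simp only [Pi.zero_apply, hmid] at *
        linarith)
    (by
      rintro a ⟨ha, -, -⟩ b ⟨hb, -, -⟩
      have : J (mid a b) = (J a + J b) / 2 := by
        simp only [hJ, hmid]
        rw [integral_div, integral_div, integral_add ha.integrable_left hb.integrable_left,
          integral_add ha.integrable_right hb.integrable_right]
        ring
      rw [this]
      linarith [le_max_left (J a) (J b), le_max_right (J a) (J b)])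
  -- The two exponentials form Cauchy sequences in `L²`.
  have hid : ∀ j k, ∫ x, (Real.exp (-((h j).1 x) / 2) - Real.exp (-((h k).1 x) / 2)) ^ 2 ∂μ +
      ∫ y, (Real.exp (-((h j).2 y) / 2) - Real.exp (-((h k).2 y) / 2)) ^ 2 ∂ν =
      F (h j) + F (h k) - 2 * F (mid (h j) (h k)) := by
    intro j k
    rw [integral_sq_sub_exp (hhK j).1.integrable_left (hhK k).1.integrable_left (hhK j).2.1
      (hhK k).2.1, integral_sq_sub_exp (hhK j).1.integrable_right (hhK k).1.integrable_right
      (hhK j).2.2 (hhK k).2.2]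
    simp only [hF, hmid]
    ring
  have hexp1 : ∀ {r : ℝ}, 0 ≤ r → |Real.exp (-r / 2)| ≤ 1 := by
    intro r hr
    rw [Real.abs_exp]
    exact Real.exp_le_one_iff.2 (by linarith)
  obtain ⟨ns, hns, l, hl⟩ := exists_subseq_ae_tendsto_of_integral_sq (μ := μ)
    (u := fun k x => Real.exp (-((h k).1 x) / 2))
    (fun k => Real.continuous_exp.comp_aestronglyMeasurable
      (((hhK k).1.integrable_left.neg).div_const 2).aestronglyMeasurable)
    (fun k => (hhK k).2.1.mono fun x hx => hexp1 hx)
    (by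
      intro ε hε
      obtain ⟨N, hN⟩ := hhF ε hε
      refine ⟨N, fun j hj k hk => ?_⟩
      have h1 := hN j hj k hk
      rw [← hid] at h1
      have : 0 ≤ ∫ y, (Real.exp (-((h j).2 y) / 2) - Real.exp (-((h k).2 y) / 2)) ^ 2 ∂ν :=
        integral_nonneg fun y => sq_nonneg _
      linarith)
  obtain ⟨ms, hms, l', hl'⟩ := exists_subseq_ae_tendsto_of_integral_sq (μ := ν)
    (u := fun k y => Real.exp (-((h (ns k)).2 y) / 2))
    (fun k => Real.continuous_exp.comp_aestronglyMeasurable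
      (((hhK (ns k)).1.integrable_right.neg).div_const 2).aestronglyMeasurable)
    (fun k => (hhK (ns k)).2.2.mono fun x hx => hexp1 hx)
    (by
      intro ε hε
      obtain ⟨N, hN⟩ := hhF ε hε
      refine ⟨N, fun j hj k hk => ?_⟩
      have h1 := hN (ns j) (hj.trans (hns.id_le j)) (ns k) (hk.trans (hns.id_le k))
      rw [← hid] at h1
      have : 0 ≤ ∫ x, (Real.exp (-((h (ns j)).1 x) / 2) -
          Real.exp (-((h (ns k)).1 x) / 2)) ^ 2 ∂μ := integral_nonneg fun y => sq_nonneg _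
      linarith)
  set q : ℕ → (X → ℝ) × (Y → ℝ) := fun k => h (ns (ms k)) with hq
  have hqK : ∀ k, q k ∈ K := fun k => hhK _
  have hqJ : Tendsto (fun k => J (q k)) atTop (𝓝 (sInf (J '' K))) :=
    hhJ.comp (hns.tendsto_atTop.comp hms.tendsto_atTop)
  obtain ⟨C, hC⟩ := hqJ.bddAbove_range
  have hqC : ∀ k, J (q k) ≤ C := fun k => hC ⟨k, rfl⟩
  obtain ⟨α, hαi, hα0, hαl, hαJ⟩ := exists_ae_tendsto_of_exp (μ := μ) (C := C)
    (α := fun k => (q k).1) (l := l) (fun k => (hqK k).1.integrable_left) (fun k => (hqK k).2.1)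
    (fun k => by
      have h1 := hqC k
      have h2 := integral_nonneg_of_ae (hqK k).2.2
      simp only [hJ] at h1
      linarith)
    (hl.mono fun x hx => hx.comp hms.tendsto_atTop)
  obtain ⟨β, hβi, hβ0, hβl, hβJ⟩ := exists_ae_tendsto_of_exp (μ := ν) (C := C)
    (α := fun k => (q k).2) (l := l') (fun k => (hqK k).1.integrable_right)
    (fun k => (hqK k).2.2)
    (fun k => by
      have h1 := hqC k
      have h2 := integral_nonneg_of_ae (hqK k).2.1
      simp only [hJ] at h1
      linarith)
    hl'
  refine ⟨α, β, ⟨hαi, hβi, ?_⟩, ?_⟩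
  · choose s hs t ht hst using fun k => (hqK k).1.le_add
    refine ⟨{x | Tendsto (fun k => (q k).1 x) atTop (𝓝 (α x))} ∩ ⋂ k, s k,
      inter_mem hαl (countable_iInter_mem.2 hs),
      {y | Tendsto (fun k => (q k).2 y) atTop (𝓝 (β y))} ∩ ⋂ k, t k,
      inter_mem hβl (countable_iInter_mem.2 ht), fun x hx y hy => ?_⟩
    exact ge_of_tendsto' (hx.1.add hy.1) fun k =>
      hst k x (Set.mem_iInter.1 hx.2 k) y (Set.mem_iInter.1 hy.2 k)
  · intro α' β' h'
    obtain ⟨a, b, hab, ha0, hb0, heq⟩ := h'.exists_nonneg hc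
    rw [← heq]
    have hle : sInf (J '' K) ≤ J (a, b) :=
      csInf_le ⟨0, by rintro _ ⟨h, hh, rfl⟩; exact hJ0 h hh⟩ ⟨(a, b), ⟨hab, ha0, hb0⟩, rfl⟩
    refine le_trans ?_ hle
    have hm0 : 0 ≤ sInf (J '' K) := le_csInf (hKne.image J)
      (by rintro _ ⟨h, hh, rfl⟩; exact hJ0 h hh)
    rw [← ENNReal.ofReal_le_ofReal_iff hm0, ENNReal.ofReal_add (integral_nonneg_of_ae hα0)
      (integral_nonneg_of_ae hβ0)]
    refine (add_le_add hαJ hβJ).trans ((liminf_add_liminf_le _ _).trans_eq ?_)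
    refine Tendsto.liminf_eq ?_
    refine ((ENNReal.continuous_ofReal.tendsto _).comp hqJ).congr fun k => ?_
    simp only [hJ, Function.comp]
    rw [ENNReal.ofReal_add (integral_nonneg_of_ae (hqK k).2.1)
      (integral_nonneg_of_ae (hqK k).2.2)]

end Dual

/-! ### Gradients and subgradients of convex functions -/

section Convex

variable {E : Type*} [NormedAddCommGroup E] [InnerProductSpace ℝ E]

/-- `q` is an `ε`-subgradient of `φ : Ω → ℝ` at `x`: the affine function of slope `q` through
`(x, φ x)` exceeds `φ` by at most `ε` on `Ω`. For `ε = 0` this is an ordinary subgradient. -/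
def IsApproxSubgradient (Ω : Set E) (φ : E → ℝ) (ε : ℝ) (x q : E) : Prop :=
  ∀ w ∈ Ω, φ x + ⟪q, w - x⟫ ≤ φ w + ε

theorem IsApproxSubgradient.mono {Ω : Set E} {φ : E → ℝ} {ε δ : ℝ} {x q : E}
    (h : IsApproxSubgradient Ω φ ε x q) (hεδ : ε ≤ δ) : IsApproxSubgradient Ω φ δ x q :=
  fun w hw => (h w hw).trans (by linarith)

theorem IsApproxSubgradient.inner_nonneg {Ω : Set E} {φ : E → ℝ} {x z p q : E}
    (hp : IsApproxSubgradient Ω φ 0 x p) (hq : IsApproxSubgradient Ω φ 0 z q) (hx : x ∈ Ω)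
    (hz : z ∈ Ω) : 0 ≤ ⟪q - p, z - x⟫ := by
  have h1 := hp z hz
  have h2 := hq x hx
  have h3 : ⟪q, x - z⟫ = -⟪q, z - x⟫ := by rw [← inner_neg_right, neg_sub]
  rw [inner_sub_left]
  linarith

/-- If `p` is a subgradient at both `x` and `z`, then it is one all along the segment, because `φ`
is affine there. -/
theorem IsApproxSubgradient.segment {Ω : Set E} {φ : E → ℝ} (hφ : ConvexOn ℝ Ω φ) {x z p : E}
    (hp : IsApproxSubgradient Ω φ 0 x p) (hq : IsApproxSubgradient Ω φ 0 z p) (hx : x ∈ Ω)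
    (hz : z ∈ Ω) {t : ℝ} (ht0 : 0 ≤ t) (ht1 : t ≤ 1) :
    IsApproxSubgradient Ω φ 0 (x + t • (z - x)) p := by
  intro w hw
  have hc := hφ.2 hx hz (sub_nonneg.2 ht1) ht0 (by ring)
  have he : (1 - t) • x + t • z = x + t • (z - x) := by module
  rw [he, smul_eq_mul, smul_eq_mul] at hc
  have h1 := hp w hw
  have h2 := hq x hx
  have h3 : ⟪p, w - (x + t • (z - x))⟫ = ⟪p, w - x⟫ + t * ⟪p, x - z⟫ := by
    rw [← inner_smul_right, ← inner_add_right]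
    congr 1
    module
  rw [h3]
  nlinarith

variable [CompleteSpace E]

theorem inner_gradient_eq_fderiv {φ : E → ℝ} {x : E} (hd : DifferentiableAt ℝ φ x) (v : E) :
    fderiv ℝ φ x v = ⟪gradient φ x, v⟫ := by
  rw [hd.hasGradientAt.hasFDerivAt.fderiv, InnerProductSpace.toDual_apply_apply]

theorem isApproxSubgradient_gradient {Ω : Set E} {φ : E → ℝ} (hφ : ConvexOn ℝ Ω φ) {x : E}
    (hx : x ∈ Ω) (hd : DifferentiableAt ℝ φ x) :
    IsApproxSubgradient Ω φ 0 x (gradient φ x) := by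
  intro w hw
  set L : ℝ →ᵃ[ℝ] E := AffineMap.lineMap x w with hL
  have hconv : ConvexOn ℝ (L ⁻¹' Ω) (φ ∘ L) := hφ.comp_affineMap L
  have hL0 : L 0 = x := AffineMap.lineMap_apply_zero x w
  have hL1 : L 1 = w := AffineMap.lineMap_apply_one x w
  have hLd : HasDerivAt L (w - x) 0 := AffineMap.hasDerivAt_lineMap
  have hder : HasDerivAt (φ ∘ L) (fderiv ℝ φ x (w - x)) 0 := by
    refine HasFDerivAt.comp_hasDerivAt (0 : ℝ) ?_ hLd
    rw [hL0]
    exact hd.hasFDerivAt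
  have := hconv.le_slope_of_hasDerivAt (x := 0) (y := 1) (by simpa [hL0] using hx)
    (by simpa [hL1] using hw) one_pos hder
  rw [inner_gradient_eq_fderiv hd] at this
  simp only [slope_def_field, Function.comp, hL0, hL1] at this
  linarith

/-- At a point `x` where `φ` is differentiable, `δ`-subgradients at points `δ`-close to `x` converge
to the gradient as `δ → 0`. -/
theorem exists_norm_sub_gradient_le {Ω : Set E} {φ : E → ℝ} {x : E} (hΩ : Ω ∈ 𝓝 x)
    (hd : DifferentiableAt ℝ φ x) (hsub : IsApproxSubgradient Ω φ 0 x (gradient φ x))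
    {η : ℝ} (hη : 0 < η) :
    ∃ δ > 0, ∀ z q, z ∈ Ω → ‖z - x‖ ≤ δ → IsApproxSubgradient Ω φ δ z q →
      ‖q - gradient φ x‖ ≤ η := by
  have hlo := hd.hasFDerivAt.isLittleO
  rw [Asymptotics.isLittleO_iff] at hlo
  obtain ⟨r, hr, hball⟩ := Metric.mem_nhds_iff.1 (inter_mem hΩ (hlo (c := η / 8) (by positivity)))
  set p := gradient φ x with hp
  -- Test the subgradient inequality at distance `r / 4` from `z` in the direction of `q - p`.
  refine ⟨min (r / 4) (r * η / 16), by positivity, fun z q hz hzx hq => ?_⟩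
  set δ := min (r / 4) (r * η / 16) with hδ
  have hδ1 : δ ≤ r / 4 := min_le_left _ _
  have hδ2 : δ ≤ r * η / 16 := min_le_right _ _
  by_cases hqp : q = p
  · simp [hqp, hη.le]
  have hn : 0 < ‖q - p‖ := norm_pos_iff.2 (sub_ne_zero.2 hqp)
  set v := (r / 4 / ‖q - p‖) • (q - p) with hv
  have hvn : ‖v‖ = r / 4 := by
    rw [hv, norm_smul, Real.norm_eq_abs, abs_of_pos (by positivity)]
    field_simp
  have hqv : ⟪q - p, v⟫ = r / 4 * ‖q - p‖ := by
    rw [hv, inner_smul_right, real_inner_self_eq_norm_sq]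
    field_simp
  have hwx : ‖z + v - x‖ ≤ r / 2 := by
    have : z + v - x = (z - x) + v := by abel
    rw [this]
    linarith [norm_add_le (z - x) v]
  have hw : z + v ∈ Metric.ball x r := by
    rw [mem_ball_iff_norm]
    linarith
  have h1 := hq _ (hball hw).1
  have h2 : ‖φ (z + v) - φ x - fderiv ℝ φ x (z + v - x)‖ ≤ η / 8 * ‖z + v - x‖ := (hball hw).2
  have h3 := (le_abs_self _).trans h2
  have h4 := hsub z hz
  rw [inner_gradient_eq_fderiv hd] at h3
  have h5 : ⟪p, z + v - x⟫ = ⟪p, z - x⟫ + ⟪p, v⟫ := by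
    rw [← inner_add_right]
    congr 1
    abel
  rw [add_sub_cancel_left] at h1
  rw [inner_sub_left] at hqv
  have h6 : η / 8 * ‖z + v - x‖ ≤ η / 8 * (r / 2) := by gcongr
  have h7 : r / 4 * ‖q - p‖ ≤ r / 4 * η := by
    rw [← hqv]
    rw [← hp, h5] at h3
    nlinarith
  exact le_of_mul_le_mul_left h7 (by positivity)

theorem IsApproxSubgradient.eq_gradient {Ω : Set E} {φ : E → ℝ} {x q : E} (hΩ : Ω ∈ 𝓝 x)
    (hd : DifferentiableAt ℝ φ x) (hsub : IsApproxSubgradient Ω φ 0 x (gradient φ x))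
    (hq : IsApproxSubgradient Ω φ 0 x q) : q = gradient φ x := by
  rw [← sub_eq_zero, ← norm_le_zero_iff]
  refine le_of_forall_pos_le_add fun η hη => ?_
  obtain ⟨δ, hδ, h⟩ := exists_norm_sub_gradient_le hΩ hd hsub hη
  rw [zero_add]
  exact h x q (mem_of_mem_nhds hΩ) (by simpa using hδ.le) (hq.mono hδ.le)

end Convex

/-! ### Alexandrov's theorem -/

/-- Local inversion at a single point: if `J` has the invertible derivative `e` at `y`, then
`y' - y` is `e⁻¹ (J y' - J y)` up to a small relative error, for `y'` close to `y`. -/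
theorem exists_norm_sub_symm_le {F : Type*} [NormedAddCommGroup F] [NormedSpace ℝ F]
    {J : F → F} {y : F}
    {e : F ≃L[ℝ] F} (hJ : HasFDerivAt J (e : F →L[ℝ] F) y) {ε : ℝ} (hε : 0 < ε) :
    ∃ δ > 0, ∀ y', ‖y' - y‖ ≤ δ → ‖y' - y - e.symm (J y' - J y)‖ ≤ ε * ‖J y' - J y‖ := by
  set C := ‖(e.symm : F →L[ℝ] F)‖ + 1 with hC
  have hC0 : 0 < C := by positivity
  have hsymm : ∀ w, ‖e.symm w‖ ≤ C * ‖w‖ := fun w =>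
    ((e.symm : F →L[ℝ] F).le_opNorm w).trans (by gcongr; simp [hC])
  set c := min (1 / (2 * C)) (ε / (2 * C ^ 2)) with hc
  have hlo := hJ.isLittleO
  rw [Asymptotics.isLittleO_iff] at hlo
  obtain ⟨r, hr, hball⟩ := Metric.mem_nhds_iff.1 (hlo (c := c) (by positivity))
  refine ⟨r / 2, by positivity, fun y' hy' => ?_⟩
  have h1 : ‖J y' - J y - e (y' - y)‖ ≤ c * ‖y' - y‖ := by
    refine hball ?_
    rw [mem_ball_iff_norm]
    linarith
  have h2 : ‖y' - y - e.symm (J y' - J y)‖ ≤ C * (c * ‖y' - y‖) := by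
    have : y' - y - e.symm (J y' - J y) = -e.symm (J y' - J y - e (y' - y)) := by
      rw [map_sub e.symm (J y' - J y), e.symm_apply_apply]
      abel
    rw [this, norm_neg]
    exact (hsymm _).trans (by gcongr)
  have hCc : C * c ≤ 1 / 2 := by
    calc C * c ≤ C * (1 / (2 * C)) := by gcongr; exact min_le_left _ _
      _ = 1 / 2 := by field_simp
  have hCc' : C * c * (2 * C) ≤ ε := by
    calc C * c * (2 * C) ≤ C * (ε / (2 * C ^ 2)) * (2 * C) := by
          gcongr; exact min_le_right _ _
      _ = ε := by field_simp
  have h3 : ‖y' - y‖ ≤ 2 * C * ‖J y' - J y‖ := by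
    have h4 := norm_le_norm_add_norm_sub' (y' - y) (e.symm (J y' - J y))
    have h5 := hsymm (J y' - J y)
    have h6 : C * c * ‖y' - y‖ ≤ 1 / 2 * ‖y' - y‖ := by gcongr
    nlinarith
  calc ‖y' - y - e.symm (J y' - J y)‖ ≤ C * c * ‖y' - y‖ := by rw [mul_assoc]; exact h2
    _ ≤ C * c * (2 * C * ‖J y' - J y‖) := by gcongr
    _ = C * c * (2 * C) * ‖J y' - J y‖ := by ring
    _ ≤ ε * ‖J y' - J y‖ := by gcongr

section Alexandrov

variable {E : Type*} [NormedAddCommGroup E] [InnerProductSpace ℝ E] [FiniteDimensional ℝ E]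

/-- `A` is the derivative at `x` of the multivalued subgradient map of `φ : Ω → ℝ`; the
subgradient at `x` itself is taken to be the gradient. -/
def HasSubgradientDerivAt (Ω : Set E) (φ : E → ℝ) (A : E →L[ℝ] E) (x : E) : Prop :=
  ∀ ε > 0, ∃ δ > 0, ∀ z ∈ Ω, ∀ q, ‖z - x‖ ≤ δ → IsApproxSubgradient Ω φ 0 z q →
    ‖q - gradient φ x - A (z - x)‖ ≤ ε * ‖z - x‖

theorem HasSubgradientDerivAt.hasFDerivWithinAt {Ω : Set E} {φ : E → ℝ}
    {A : E →L[ℝ] E} {x : E} (hA : HasSubgradientDerivAt Ω φ A x)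
    (hφ : ConvexOn ℝ Ω φ) (hΩ : Ω ∈ 𝓝 x) :
    HasFDerivWithinAt (gradient φ) A {z | DifferentiableAt ℝ φ z} x := by
  rw [hasFDerivWithinAt_iff_isLittleO, Asymptotics.isLittleO_iff]
  intro ε hε
  obtain ⟨δ, hδ, h⟩ := hA ε hε
  filter_upwards [mem_nhdsWithin_of_mem_nhds hΩ, self_mem_nhdsWithin,
    mem_nhdsWithin_of_mem_nhds (Metric.closedBall_mem_nhds x hδ)] with z hz hzd hzb
  exact h z hz _ (mem_closedBall_iff_norm.1 hzb) (isApproxSubgradient_gradient hφ hz hzd)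

/-- If the gradient at `x` is also a subgradient at `z ≠ x`, it is one on the segment from `x` to
`z`, so `A` annihilates `z - x`. -/
theorem HasSubgradientDerivAt.eq_of_isApproxSubgradient {Ω : Set E} {φ : E → ℝ}
    {A : E →L[ℝ] E} {x : E} (hA : HasSubgradientDerivAt Ω φ A x)
    (hφ : ConvexOn ℝ Ω φ) (hx : x ∈ Ω) (hd : DifferentiableAt ℝ φ x) (hdet : A.det ≠ 0) {z : E}
    (hz : z ∈ Ω) (hq : IsApproxSubgradient Ω φ 0 z (gradient φ x)) : z = x := by
  have hp := isApproxSubgradient_gradient hφ hx hd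
  have hAv : A (z - x) = 0 := by
    rw [← norm_le_zero_iff]
    refine le_of_forall_pos_le_add fun η hη => ?_
    obtain ⟨δ, hδ, h⟩ := hA (η / (‖z - x‖ + 1)) (by positivity)
    set t := min 1 (δ / (‖z - x‖ + 1)) with ht
    have ht0 : 0 < t := by positivity
    have ht1 : t ≤ 1 := min_le_left _ _
    have htδ : t * ‖z - x‖ ≤ δ := by
      calc t * ‖z - x‖ ≤ δ / (‖z - x‖ + 1) * (‖z - x‖ + 1) := by
            gcongr
            · exact min_le_right _ _
            · linarith
        _ = δ := by field_simp
    have hmem : x + t • (z - x) ∈ Ω := by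
      have := hφ.1 hx hz (sub_nonneg.2 ht1) ht0.le (by ring)
      convert this using 1
      module
    have h1 := h _ hmem _ (by
      rw [add_sub_cancel_left, norm_smul, Real.norm_eq_abs, abs_of_pos ht0]
      exact htδ) (hp.segment hφ hq hx hz ht0.le ht1)
    rw [add_sub_cancel_left, sub_self, zero_sub, norm_neg, map_smul, norm_smul, norm_smul,
      Real.norm_eq_abs, abs_of_pos ht0] at h1
    have h2 : ‖A (z - x)‖ ≤ η / (‖z - x‖ + 1) * ‖z - x‖ := by
      refine le_of_mul_le_mul_left (h1.trans_eq ?_) ht0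
      ring
    have h3 : η / (‖z - x‖ + 1) * ‖z - x‖ ≤ η := by
      rw [div_mul_eq_mul_div, div_le_iff₀ (by positivity)]
      nlinarith
    linarith
  have h4 : (A.toContinuousLinearEquivOfDetNeZero hdet) (z - x) = 0 := by simpa using hAv
  exact sub_eq_zero.1 ((ContinuousLinearEquiv.map_eq_zero_iff _).1 h4)

/-- No symmetry of `A` is needed. -/
theorem det_nonneg_of_inner_nonneg {A : E →L[ℝ] E} (hA : ∀ v, 0 ≤ ⟪A v, v⟫) : 0 ≤ A.det := by
  -- Along the segment from the identity to `A` the determinant is nonzero before the endpoint.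
  set d : ℝ → ℝ := fun t => ((1 - t) • ContinuousLinearMap.id ℝ E + t • A).det with hd
  have hcont : Continuous d := by
    refine ContinuousLinearMap.continuous_det.comp ?_
    fun_prop
  have hne : ∀ t ∈ Ico (0 : ℝ) 1, d t ≠ 0 := by
    intro t ht h0
    obtain ⟨v, hv, hv0⟩ : ∃ v, ((1 - t) • ContinuousLinearMap.id ℝ E + t • A) v = 0 ∧ v ≠ 0 := by
      have hker := LinearMap.bot_lt_ker_of_det_eq_zero
        (f := (((1 - t) • ContinuousLinearMap.id ℝ E + t • A : E →L[ℝ] E) : E →ₗ[ℝ] E)) h0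
      obtain ⟨v, hv, hv0⟩ := Submodule.exists_mem_ne_zero_of_ne_bot hker.ne'
      exact ⟨v, by simpa using hv, hv0⟩
    have h1 : ⟪((1 - t) • ContinuousLinearMap.id ℝ E + t • A) v, v⟫ = 0 := by
      rw [hv, inner_zero_left]
    have h2 : ⟪((1 - t) • ContinuousLinearMap.id ℝ E + t • A) v, v⟫ =
        (1 - t) * ‖v‖ ^ 2 + t * ⟪A v, v⟫ := by
      simp [inner_add_left, real_inner_smul_left]
    have h3 : 0 < (1 - t) * ‖v‖ ^ 2 :=
      mul_pos (by linarith [ht.2]) (by have := norm_pos_iff.2 hv0; positivity)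
    nlinarith [hA v, ht.1]
  have hd0 : d 0 = 1 := by simp [hd, ContinuousLinearMap.det]
  have hd1 : d 1 = A.det := by simp [hd]
  have hpos : ∀ t ∈ Ico (0 : ℝ) 1, 0 ≤ d t := by
    intro t ht
    by_contra hlt
    push Not at hlt
    obtain ⟨s, hs, hs0⟩ := intermediate_value_Icc' ht.1 hcont.continuousOn
      ⟨hlt.le, by rw [hd0]; exact zero_le_one⟩
    exact hne s ⟨hs.1, hs.2.trans_lt ht.2⟩ hs0
  rw [← hd1]
  have : (1 : ℝ) ∈ closure (Ico (0 : ℝ) 1) := by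
    rw [closure_Ico zero_ne_one]
    exact right_mem_Icc.2 zero_le_one
  exact closure_minimal hpos (isClosed_Ici.preimage hcont) this

variable [MeasurableSpace E] [BorelSpace E]

theorem ae_differentiableAt_of_convexOn {Ω : Set E} {φ : E → ℝ} (hΩ : IsOpen Ω)
    (hφ : ConvexOn ℝ Ω φ) : ∀ᵐ x, x ∈ Ω → DifferentiableAt ℝ φ x := by
  rw [ae_iff]
  refine measure_null_of_locally_null _ fun x hx => ?_
  obtain ⟨hxΩ, -⟩ : x ∈ Ω ∧ ¬DifferentiableAt ℝ φ x := Classical.not_imp.1 hx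
  obtain ⟨K, t, ht, hL⟩ := hφ.locallyLipschitzOn hΩ hxΩ
  rw [hΩ.nhdsWithin_eq hxΩ] at ht
  refine ⟨_, inter_mem self_mem_nhdsWithin
    (mem_nhdsWithin_of_mem_nhds (interior_mem_nhds.2 ht)), ?_⟩
  have hae := (hL.mono interior_subset).ae_differentiableWithinAt_of_mem (μ := volume)
  refine measure_mono_null ?_ (ae_iff.1 hae)
  rintro z ⟨hz, hzt⟩ hzd
  exact hz fun _ => (hzd hzt).differentiableAt (isOpen_interior.mem_nhds hzt)

theorem volume_image_eq_zero_of_lipschitzWith {K : NNReal} {J : E → E} (hJ : LipschitzWith K J)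
    {s : Set E} (hs : volume s = 0) : volume (J '' s) = 0 := by
  have h1 : (volume : Measure E) ≪ μH[Module.finrank ℝ E] :=
    Measure.absolutelyContinuous_isAddHaarMeasure _ _
  have h2 : μH[Module.finrank ℝ E] ≪ (volume : Measure E) :=
    Measure.absolutelyContinuous_isAddHaarMeasure _ _
  refine h1 (le_antisymm ?_ bot_le)
  refine (hJ.hausdorffMeasure_image_le (Nat.cast_nonneg _) s).trans_eq ?_
  rw [h2 hs, mul_zero]

/-- **Alexandrov's theorem**. The resolvent `J = (id + ∂φ)⁻¹` is nonexpansive by monotonicity of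
`∂φ`, hence differentiable almost everywhere. The image under `J` of the set where its derivative
fails to exist or to be invertible is null, and elsewhere `∂φ = J⁻¹ - id` is differentiable.The map
`J` is only defined on the range of `id + ∂φ`; a Lipschitz extension to the whole space serves as well,
so that surjectivity of `id + ∂φ` is not needed. -/
theorem ae_hasSubgradientDerivAt {Ω : Set E} {φ : E → ℝ} (hΩ : IsOpen Ω)
    (hφ : ConvexOn ℝ Ω φ) :
    ∀ᵐ x, x ∈ Ω → DifferentiableAt ℝ φ x ∧ ∃ A : E →L[ℝ] E, HasSubgradientDerivAt Ω φ A x := by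
  set R : Set E := {y | ∃ x ∈ Ω, IsApproxSubgradient Ω φ 0 x (y - x)} with hR
  choose! J₀ hJ₀Ω hJ₀ using (fun y (hy : y ∈ R) => hy)
  have hmono : ∀ {x z p q : E}, x ∈ Ω → z ∈ Ω → IsApproxSubgradient Ω φ 0 x p →
      IsApproxSubgradient Ω φ 0 z q → ‖z - x‖ ≤ ‖(z + q) - (x + p)‖ := by
    intro x z p q hx hz hp hq
    have h1 := hp.inner_nonneg hq hx hz
    have h2 : (z + q) - (x + p) = (z - x) + (q - p) := by abel
    refine le_of_sq_le_sq ?_ (norm_nonneg _)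
    rw [h2, norm_add_sq_real, real_inner_comm]
    nlinarith [sq_nonneg ‖q - p‖]
  have hlip : LipschitzOnWith 1 J₀ R := by
    refine LipschitzOnWith.of_dist_le_mul fun y hy y' hy' => ?_
    have := hmono (hJ₀Ω y' hy') (hJ₀Ω y hy) (hJ₀ y' hy') (hJ₀ y hy)
    simpa [dist_eq_norm] using this
  obtain ⟨J, hJ, hJeq⟩ := hlip.extend_finite_dimension
  have hJsub : ∀ {z q : E}, z ∈ Ω → IsApproxSubgradient Ω φ 0 z q → J (z + q) = z := by
    intro z q hz hq
    have hmem : z + q ∈ R := ⟨z, hz, by simpa using hq⟩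
    rw [← hJeq hmem]
    have := hmono hz (hJ₀Ω _ hmem) hq (hJ₀ _ hmem)
    simpa [sub_eq_zero] using this
  have hnull1 : volume (J '' {y | ¬DifferentiableAt ℝ J y}) = 0 :=
    volume_image_eq_zero_of_lipschitzWith hJ (ae_iff.1 hJ.ae_differentiableAt)
  have hnull2 : volume (J '' {y | DifferentiableAt ℝ J y ∧ (fderiv ℝ J y).det = 0}) = 0 :=
    addHaar_image_eq_zero_of_det_fderivWithin_eq_zero _
      (fun y hy => hy.1.hasFDerivAt.hasFDerivWithinAt) fun y hy => hy.2
  filter_upwards [ae_differentiableAt_of_convexOn hΩ hφ, measure_eq_zero_iff_ae_notMem.1 hnull1,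
    measure_eq_zero_iff_ae_notMem.1 hnull2] with x hxd hx1 hx2 hxΩ
  have hd := hxd hxΩ
  refine ⟨hd, ?_⟩
  have hsub := isApproxSubgradient_gradient hφ hxΩ hd
  set p := gradient φ x with hp
  have hJx : J (x + p) = x := hJsub hxΩ hsub
  have hJd : DifferentiableAt ℝ J (x + p) := by
    by_contra h
    exact hx1 ⟨x + p, h, hJx⟩
  have hdet : (fderiv ℝ J (x + p)).det ≠ 0 := fun h => hx2 ⟨x + p, ⟨hJd, h⟩, hJx⟩
  set e := (fderiv ℝ J (x + p)).toContinuousLinearEquivOfDetNeZero hdet with he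
  have hJe : HasFDerivAt J (e : E →L[ℝ] E) (x + p) := by
    rw [he, ContinuousLinearMap.coe_toContinuousLinearEquivOfDetNeZero]
    exact hJd.hasFDerivAt
  refine ⟨(e.symm : E →L[ℝ] E) - ContinuousLinearMap.id ℝ E, fun ε hε => ?_⟩
  obtain ⟨δ, hδ, hinv⟩ := exists_norm_sub_symm_le hJe hε
  obtain ⟨δ', hδ', hcl⟩ := exists_norm_sub_gradient_le (hΩ.mem_nhds hxΩ) hd hsub (half_pos hδ)
  refine ⟨min (δ / 2) δ', by positivity, fun z hz q hzx hq => ?_⟩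
  have h1 := hcl z q hz (hzx.trans (min_le_right _ _)) (hq.mono hδ'.le)
  have h2 := hinv (z + q) (by
    have h3 : z + q - (x + p) = (z - x) + (q - p) := by abel
    rw [h3]
    linarith [norm_add_le (z - x) (q - p), hzx.trans (min_le_left _ _)])
  rw [hJsub hz hq, hJx] at h2
  convert h2 using 2
  simp only [_root_.sub_apply, ContinuousLinearEquiv.coe_coe,
    ContinuousLinearMap.id_apply]
  abel

/-- Monotonicity of the gradient makes `A` positive semidefinite: differentiability points are
dense, so each open cone with apex `x` contains some of them arbitrarily close to `x`. -/
theorem HasSubgradientDerivAt.inner_nonneg {Ω : Set E} {φ : E → ℝ}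
    {A : E →L[ℝ] E} {x : E} (hA : HasSubgradientDerivAt Ω φ A x)
    (hΩ : IsOpen Ω) (hφ : ConvexOn ℝ Ω φ) (hx : x ∈ Ω) (hd : DifferentiableAt ℝ φ x) (v : E) :
    0 ≤ ⟪A v, v⟫ := by
  by_contra hv
  push Not at hv
  have hv0 : v ≠ 0 := by
    rintro rfl
    simp at hv
  have hvn : 0 < ‖v‖ ^ 2 := by have := norm_pos_iff.2 hv0; positivity
  obtain ⟨c, hc0, hc⟩ : ∃ c : ℝ, 0 < c ∧ ⟪A v, v⟫ < -(c * ‖v‖ ^ 2) := by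
    refine ⟨-⟪A v, v⟫ / (2 * ‖v‖ ^ 2), div_pos (by linarith) (by positivity), ?_⟩
    field_simp
    linarith
  obtain ⟨δ, hδ, h⟩ := hA c hc0
  set U : Set E := {z | ⟪A (z - x), z - x⟫ < -(c * ‖z - x‖ ^ 2)} ∩ (Metric.ball x δ ∩ Ω) with hU
  have hUo : IsOpen U := by
    refine (isOpen_lt ?_ ?_).inter (Metric.isOpen_ball.inter hΩ) <;> fun_prop
  have hUne : U.Nonempty := by
    have hcont : Tendsto (fun t : ℝ => x + t • v) (𝓝[>] 0) (𝓝 x) := by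
      have : Continuous fun t : ℝ => x + t • v := by fun_prop
      simpa using (this.tendsto 0).mono_left nhdsWithin_le_nhds
    have hev := hcont.eventually
      (inter_mem (Metric.ball_mem_nhds x hδ) (hΩ.mem_nhds hx))
    obtain ⟨t, ht, ht0⟩ := (hev.and self_mem_nhdsWithin).exists
    refine ⟨x + t • v, ?_, ht⟩
    have ht0 : 0 < t := ht0
    simp only [mem_ofPred_eq, add_sub_cancel_left, map_smul, real_inner_smul_left,
      real_inner_smul_right, norm_smul, Real.norm_eq_abs, mul_pow, sq_abs]
    have := mul_lt_mul_of_pos_left hc (pow_pos ht0 2)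
    linarith
  have hpos : volume U ≠ 0 := (hUo.measure_pos _ hUne).ne'
  obtain ⟨z, hzU, hzd⟩ : ∃ z ∈ U, DifferentiableAt ℝ φ z := by
    by_contra hcon
    push Not at hcon
    refine hpos (measure_mono_null ?_ (ae_iff.1 (ae_differentiableAt_of_convexOn hΩ hφ)))
    intro z hz hzi
    exact hcon z hz (hzi hz.2.2)
  have hsub := isApproxSubgradient_gradient hφ hzU.2.2 hzd
  have h1 := h z hzU.2.2 _ (mem_ball_iff_norm.1 hzU.2.1).le hsub
  have h2 := (isApproxSubgradient_gradient hφ hx hd).inner_nonneg hsub hx hzU.2.2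
  have h3 : ⟪A (z - x), z - x⟫ < -(c * ‖z - x‖ ^ 2) := hzU.1
  have h4 : ⟪gradient φ z - gradient φ x - A (z - x), z - x⟫ ≤ c * ‖z - x‖ * ‖z - x‖ :=
    (real_inner_le_norm _ _).trans (by gcongr)
  rw [inner_sub_left] at h4
  nlinarith

end Alexandrov

/-! ### Legendre transforms -/

section Legendre

variable {E : Type*} [NormedAddCommGroup E] [InnerProductSpace ℝ E]

/-- The Legendre transform of `ψ : Y → ℝ`, with junk values where the supremum is infinite, that is,
outside `legendreDom Y ψ`. -/
noncomputable def legendre (Y : Set E) (ψ : E → ℝ) (x : E) : ℝ := ⨆ y : Y, (⟪x, (y : E)⟫ - ψ y)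

/-- The set where the Legendre transform of `ψ : Y → ℝ` is finite. -/
def legendreDom (Y : Set E) (ψ : E → ℝ) : Set E :=
  {x | BddAbove (range fun y : Y => ⟪x, (y : E)⟫ - ψ y)}

variable {Y : Set E} {ψ : E → ℝ} {x y : E}

theorem mem_legendreDom_of_le {b : ℝ} (h : ∀ y ∈ Y, ⟪x, y⟫ - ψ y ≤ b) : x ∈ legendreDom Y ψ :=
  ⟨b, by rintro _ ⟨y, rfl⟩; exact h y y.2⟩

theorem le_legendre (hx : x ∈ legendreDom Y ψ) (hy : y ∈ Y) : ⟪x, y⟫ - ψ y ≤ legendre Y ψ x :=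
  le_ciSup (f := fun y : Y => ⟪x, (y : E)⟫ - ψ y) hx ⟨y, hy⟩

theorem legendre_le (hY : Y.Nonempty) {b : ℝ} (h : ∀ y ∈ Y, ⟪x, y⟫ - ψ y ≤ b) :
    legendre Y ψ x ≤ b :=
  have := hY.to_subtype
  ciSup_le fun y => h y y.2

theorem exists_lt_of_lt_legendre (hY : Y.Nonempty) {b : ℝ} (h : b < legendre Y ψ x) :
    ∃ y ∈ Y, b < ⟪x, y⟫ - ψ y := by
  have := hY.to_subtype
  obtain ⟨y, hy⟩ := exists_lt_of_lt_ciSup h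
  exact ⟨y, y.2, hy⟩

theorem inner_combo_sub_le {z : E} {a b : ℝ} (ha : 0 ≤ a) (hb : 0 ≤ b) (hab : a + b = 1)
    (hx : x ∈ legendreDom Y ψ) (hz : z ∈ legendreDom Y ψ) (hy : y ∈ Y) :
    ⟪a • x + b • z, y⟫ - ψ y ≤ a * legendre Y ψ x + b * legendre Y ψ z := by
  have h1 := mul_le_mul_of_nonneg_left (le_legendre hx hy) ha
  have h2 := mul_le_mul_of_nonneg_left (le_legendre hz hy) hb
  rw [inner_add_left, real_inner_smul_left, real_inner_smul_left]
  have h3 : ψ y = a * ψ y + b * ψ y := by rw [← add_mul, hab, one_mul]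
  linarith

theorem convexOn_legendre (hY : Y.Nonempty) :
    ConvexOn ℝ (legendreDom Y ψ) (legendre Y ψ) :=
  ⟨fun _ hx _ hz _ _ ha hb hab =>
      mem_legendreDom_of_le fun _ hy => inner_combo_sub_le ha hb hab hx hz hy,
    fun _ hx _ hz _ _ ha hb hab =>
      legendre_le hY fun _ hy => inner_combo_sub_le ha hb hab hx hz hy⟩

/-- Almost maximizers in the Legendre transform are approximate subgradients. -/
theorem isApproxSubgradient_legendre {ε : ℝ} (hy : y ∈ Y)
    (h : legendre Y ψ x ≤ ⟪x, y⟫ - ψ y + ε) :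
    IsApproxSubgradient (legendreDom Y ψ) (legendre Y ψ) ε x y := by
  intro w hw
  have h1 := le_legendre hw hy
  rw [inner_sub_right, real_inner_comm w y, real_inner_comm x y]
  linarith

/-- A bounded perturbation of `ψ` changes its Legendre transform by at most the bound. -/
theorem abs_legendre_sub_le (hY : Y.Nonempty) {ψ' : E → ℝ} {M : ℝ}
    (hM : ∀ y, |ψ' y - ψ y| ≤ M) (hx : x ∈ legendreDom Y ψ) :
    x ∈ legendreDom Y ψ' ∧ |legendre Y ψ' x - legendre Y ψ x| ≤ M := by
  have h1 : ∀ y ∈ Y, ⟪x, y⟫ - ψ' y ≤ legendre Y ψ x + M := fun y hy => by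
    linarith [le_legendre hx hy, (abs_le.1 (hM y)).1]
  have hx' := mem_legendreDom_of_le h1
  refine ⟨hx', abs_sub_le_iff.2 ⟨by linarith [legendre_le hY h1], ?_⟩⟩
  have h2 : legendre Y ψ x ≤ legendre Y ψ' x + M := legendre_le hY fun y hy => by
    linarith [le_legendre hx' hy, (abs_le.1 (hM y)).2]
  linarith

/-- At a point of differentiability, the derivative of the Legendre transform in the direction of a
bounded perturbation `h` of `ψ` is `-h`, evaluated at the gradient. -/
theorem tendsto_slope_legendre [CompleteSpace E] (hY : Y.Nonempty) {h : E → ℝ} {M : ℝ}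
    (hM : ∀ y, |h y| ≤ M) (hx : x ∈ interior (legendreDom Y ψ))
    (hd : DifferentiableAt ℝ (legendre Y ψ) x)
    (hc : ContinuousAt h (gradient (legendre Y ψ) x)) :
    Tendsto (fun t : ℝ => (legendre Y (fun y => ψ y + t * h y) x - legendre Y ψ x) / t)
      (𝓝[>] 0) (𝓝 (-h (gradient (legendre Y ψ) x))) := by
  have hM0 : 0 ≤ M := (abs_nonneg _).trans (hM 0)
  have hxD := interior_subset hx
  have hsub := isApproxSubgradient_gradient (convexOn_legendre hY) hxD hd
  set φ := legendre Y ψ with hφ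
  set p := gradient φ x with hp
  rw [Metric.tendsto_nhds]
  intro η hη
  obtain ⟨δ, hδ, hδh⟩ := Metric.continuousAt_iff.1 hc (η / 2) (half_pos hη)
  obtain ⟨δ', hδ', hgrad⟩ :=
    exists_norm_sub_gradient_le (mem_interior_iff_mem_nhds.1 hx) hd hsub (half_pos hδ)
  have hclose : ∀ y ∈ Y, φ x ≤ ⟪x, y⟫ - ψ y + δ' → |h y - h p| < η / 2 := by
    intro y hy hyx
    have h1 := hgrad x y hxD (by simpa using hδ'.le) (isApproxSubgradient_legendre hy hyx)
    have h2 := hδh (x := y) (by rw [dist_eq_norm]; linarith)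
    rwa [Real.dist_eq] at h2
  have hsmall : ∀ᶠ t : ℝ in 𝓝[>] 0, t * (2 * M + 1) < δ' ∧ t < η / 2 ∧ t < 1 := by
    have h1 : Tendsto (fun t : ℝ => t * (2 * M + 1)) (𝓝[>] 0) (𝓝 0) := by
      have : Continuous fun t : ℝ => t * (2 * M + 1) := by fun_prop
      simpa using (this.tendsto 0).mono_left nhdsWithin_le_nhds
    have h2 : Tendsto (fun t : ℝ => t) (𝓝[>] 0) (𝓝 0) := nhdsWithin_le_nhds
    exact (h1.eventually_lt_const hδ').and
      ((h2.eventually_lt_const (half_pos hη)).and (h2.eventually_lt_const one_pos))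
  filter_upwards [hsmall, self_mem_nhdsWithin] with t ⟨ht1, ht2, ht3⟩ ht0
  have ht0 : 0 < t := ht0
  have htsq : t * t ≤ t := by nlinarith
  have htM : t * (2 * M + 1) = t * M + t * M + t := by ring
  have htM0 : 0 ≤ t * M := by positivity
  obtain ⟨hxt, hdiff⟩ := abs_legendre_sub_le (ψ' := fun y => ψ y + t * h y) hY (M := t * M)
    (fun y => by
      rw [add_sub_cancel_left, abs_mul, abs_of_pos ht0]
      exact mul_le_mul_of_nonneg_left (hM y) ht0.le) hxD
  have hup : legendre Y (fun y => ψ y + t * h y) x - φ x < t * (-h p + η) := by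
    obtain ⟨y, hy, hyx⟩ := exists_lt_of_lt_legendre hY
      (show legendre Y (fun y => ψ y + t * h y) x - t * t < _ by
        linarith [mul_pos ht0 ht0])
    have h1 := mul_le_mul_of_nonneg_left (abs_le.1 (hM y)).1 ht0.le
    have h2 := hclose y hy (by linarith [(abs_le.1 hdiff).1])
    have h3 := mul_lt_mul_of_pos_left (abs_lt.1 h2).1 ht0
    have h4 := le_legendre hxD hy
    have h5 := mul_lt_mul_of_pos_left ht2 ht0
    linarith
  have hlow : t * (-h p - η) < legendre Y (fun y => ψ y + t * h y) x - φ x := by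
    obtain ⟨y, hy, hyx⟩ := exists_lt_of_lt_legendre hY
      (show φ x - t * t < _ by linarith [mul_pos ht0 ht0])
    have h2 := hclose y hy (by linarith)
    have h3 := mul_lt_mul_of_pos_left (abs_lt.1 h2).2 ht0
    have h4 := le_legendre hxt hy
    have h5 := mul_lt_mul_of_pos_left ht2 ht0
    linarith
  rw [Real.dist_eq, abs_lt]
  constructor
  · have := (lt_div_iff₀' ht0).2 hlow
    linarith
  · have := (div_lt_iff₀' ht0).2 hup
    linarith

/-- Equality in Young's inequality at the gradient. -/
theorem legendre_gradient [CompleteSpace E] {Ω : Set E} {φ : E → ℝ} (hφ : ConvexOn ℝ Ω φ)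
    (hx : x ∈ Ω) (hd : DifferentiableAt ℝ φ x) :
    ⟪x, gradient φ x⟫ = φ x + legendre Ω φ (gradient φ x) := by
  have hle : ∀ z ∈ Ω, ⟪gradient φ x, z⟫ - φ z ≤ ⟪gradient φ x, x⟫ - φ x := by
    intro z hz
    have := isApproxSubgradient_gradient hφ hx hd z hz
    rw [inner_sub_right] at this
    linarith
  have h1 := legendre_le ⟨x, hx⟩ hle
  have h2 := le_legendre (mem_legendreDom_of_le hle) hx
  rw [real_inner_comm]
  linarith

/-- Equality in Young's inequality characterizes the gradient. -/
theorem eq_gradient_of_inner_eq [CompleteSpace E] {Ω : Set E} {φ : E → ℝ} (hφ : ConvexOn ℝ Ω φ)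
    (hΩ : IsOpen Ω) (hx : x ∈ Ω) (hd : DifferentiableAt ℝ φ x) (hy : y ∈ legendreDom Ω φ)
    (h : ⟪x, y⟫ = φ x + legendre Ω φ y) : y = gradient φ x := by
  refine IsApproxSubgradient.eq_gradient (hΩ.mem_nhds hx) hd
    (isApproxSubgradient_gradient hφ hx hd) fun w hw => ?_
  have := le_legendre hy hw
  rw [inner_sub_right, real_inner_comm x y]
  linarith

variable [FiniteDimensional ℝ E] [MeasurableSpace E] [BorelSpace E]

/-- As the boundary of a convex set is null, `ρ`-almost every point is interior to the domain of the
Legendre transform; integrability follows from the upper bound `b` and an affine lower bound. -/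
theorem integrable_legendre {ρ : Measure E} [IsProbabilityMeasure ρ] (hρ : ρ ≪ volume)
    (hm : Integrable (fun x => ‖x‖) ρ) (hY : Y.Nonempty) {b : E → ℝ} (hb : Integrable b ρ)
    (hle : ∀ᵐ x ∂ρ, ∀ y ∈ Y, ⟪x, y⟫ - ψ y ≤ b x) :
    (∀ᵐ x ∂ρ, x ∈ interior (legendreDom Y ψ)) ∧ Integrable (legendre Y ψ) ρ := by
  have hconv := convexOn_legendre (ψ := ψ) hY
  have hfr : ∀ᵐ x ∂ρ, x ∉ frontier (legendreDom Y ψ) :=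
    hρ.ae_le (measure_eq_zero_iff_ae_notMem.1 (hconv.1.addHaar_frontier volume))
  have hint : ∀ᵐ x ∂ρ, x ∈ interior (legendreDom Y ψ) := by
    filter_upwards [hle, hfr] with x hx hxf
    rw [← self_sdiff_frontier]
    exact ⟨mem_legendreDom_of_le hx, hxf⟩
  refine ⟨hint, ?_⟩
  obtain ⟨y₀, hy₀⟩ := hY
  have hmeas : AEStronglyMeasurable (legendre Y ψ) ρ := by
    rw [← Measure.restrict_eq_self_of_ae_mem hint]
    exact hconv.continuousOn_interior.aestronglyMeasurable isOpen_interior.measurableSet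
  refine Integrable.mono' ((hb.abs.add (hm.mul_const ‖y₀‖)).add (integrable_const |ψ y₀|))
    hmeas ?_
  filter_upwards [hle] with x hx
  have h1 := le_legendre (mem_legendreDom_of_le hx) hy₀
  have h2 := legendre_le ⟨y₀, hy₀⟩ hx
  have h3 := neg_le_of_abs_le (abs_real_inner_le_norm x y₀)
  simp only [Pi.add_apply, Real.norm_eq_abs]
  refine abs_le.2 ⟨?_, ?_⟩
  · linarith [le_abs_self (ψ y₀), abs_nonneg (b x)]
  · have : 0 ≤ ‖x‖ * ‖y₀‖ := by positivity
    linarith [abs_nonneg (ψ y₀), le_abs_self (b x)]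

end Legendre

/-! ### The transport map as a gradient -/

section Brenier

variable {E : Type*} [NormedAddCommGroup E] [InnerProductSpace ℝ E] [FiniteDimensional ℝ E]
  [MeasurableSpace E] [BorelSpace E]

theorem integrable_norm_of_sq {ρ : Measure E} [IsFiniteMeasure ρ]
    (h : Integrable (fun x => ‖x‖ ^ 2) ρ) : Integrable (fun x => ‖x‖) ρ := by
  refine Integrable.mono' (h.add (integrable_const 1)) (by fun_prop)
    (Eventually.of_forall fun x => ?_)
  simp only [Pi.add_apply, norm_norm]
  nlinarith [sq_nonneg (‖x‖ - 1)]

theorem measurable_gradient (φ : E → ℝ) : Measurable (gradient φ) :=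
  (InnerProductSpace.toDual ℝ E).symm.continuous.measurable.comp (measurable_fderiv ℝ φ)

/-- The Euler–Lagrange equation of the dual problem: the potential obtained from a dual minimizer
has a gradient pushing `μ` forward to `ν`. -/
theorem exists_potential {μ ν : Measure E} [IsProbabilityMeasure μ] [IsProbabilityMeasure ν]
    (hμ : μ ≪ volume) (hμ2 : Integrable (fun x => ‖x‖ ^ 2) μ)
    (hν2 : Integrable (fun x => ‖x‖ ^ 2) ν) :
    ∃ (Y : Set E) (ψ : E → ℝ), Y ∈ ae ν ∧ Integrable ψ ν ∧
      (∀ᵐ x ∂μ, x ∈ interior (legendreDom Y ψ)) ∧ Integrable (legendre Y ψ) μ ∧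
      μ.map (gradient (legendre Y ψ)) = ν := by
  have hexp : ∀ x y : E, 1 / 2 * ‖x + y‖ ^ 2 = 1 / 2 * ‖x‖ ^ 2 + ⟪x, y⟫ + 1 / 2 * ‖y‖ ^ 2 := by
    intro x y
    rw [norm_add_sq_real]
    ring
  obtain ⟨α, β, hαβ, hmin⟩ := exists_dual_minimizer (μ := μ) (ν := ν)
    (c := fun x y => 1 / 2 * ‖x + y‖ ^ 2) (fun x y => by positivity)
    ⟨fun x => ‖x‖ ^ 2, fun y => ‖y‖ ^ 2, hμ2, hν2, univ, univ_mem, univ, univ_mem,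
      fun x _ y _ => by
        rw [hexp]
        nlinarith [real_inner_le_norm x y, sq_nonneg (‖x‖ - ‖y‖)]⟩
  obtain ⟨s, hs, Y, hYae, hst⟩ := hαβ.le_add
  have hY : Y.Nonempty := nonempty_of_mem hYae
  set ψ : E → ℝ := fun y => β y - 1 / 2 * ‖y‖ ^ 2 with hψ
  have hψi : Integrable ψ ν := hαβ.integrable_right.sub (hν2.const_mul _)
  set b : E → ℝ := fun x => α x - 1 / 2 * ‖x‖ ^ 2 with hb
  have hbi : Integrable b μ := hαβ.integrable_left.sub (hμ2.const_mul _)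
  have hle : ∀ᵐ x ∂μ, ∀ y ∈ Y, ⟪x, y⟫ - ψ y ≤ b x := by
    filter_upwards [hs] with x hx y hy
    have := hst x hx y hy
    rw [hexp] at this
    simp only [hψ, hb]
    linarith
  have hm := integrable_norm_of_sq hμ2
  obtain ⟨hint, hφi⟩ := integrable_legendre hμ hm hY hbi hle
  refine ⟨Y, ψ, hYae, hψi, hint, hφi, ?_⟩
  set φ := legendre Y ψ with hφ
  have hconv : ConvexOn ℝ (interior (legendreDom Y ψ)) φ :=
    (convexOn_legendre hY).subset interior_subset (convexOn_legendre hY).1.interior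
  have hdiff : ∀ᵐ x ∂μ, DifferentiableAt ℝ φ x := by
    filter_upwards [hint, hμ.ae_le (ae_differentiableAt_of_convexOn isOpen_interior hconv)]
      with x hx hxd using hxd hx
  have hgm : Measurable (gradient φ) := measurable_gradient φ
  have key : ∀ h : E →ᵇ ℝ, ∫ x, h (gradient φ x) ∂μ ≤ ∫ y, h y ∂ν := by
    intro h
    have hM : ∀ y, |h y| ≤ ‖h‖ := fun y => h.norm_coe_le_norm y
    have hhi : Integrable h ν := h.integrable ν
    set τ : ℕ → ℝ := fun k => 1 / ((k : ℝ) + 1) with hτ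
    have hτ0 : ∀ k, 0 < τ k := fun k => Nat.one_div_pos_of_nat
    have hτlim : Tendsto τ atTop (𝓝[>] 0) := tendsto_nhdsWithin_iff.2
      ⟨tendsto_one_div_add_atTop_nhds_zero_nat, Eventually.of_forall hτ0⟩
    have hpert : ∀ k, ∀ x ∈ legendreDom Y ψ,
        x ∈ legendreDom Y (fun y => ψ y + τ k * h y) ∧
        |legendre Y (fun y => ψ y + τ k * h y) x - φ x| ≤ τ k * ‖h‖ := fun k x hx =>
      abs_legendre_sub_le hY (fun y => by
        rw [add_sub_cancel_left, abs_mul, abs_of_pos (hτ0 k)]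
        exact mul_le_mul_of_nonneg_left (hM y) (hτ0 k).le) hx
    have hφki : ∀ k, Integrable (legendre Y (fun y => ψ y + τ k * h y)) μ := by
      intro k
      refine (integrable_legendre hμ hm hY (hφi.add (integrable_const (τ k * ‖h‖))) ?_).2
      filter_upwards [hint] with x hx y hy
      obtain ⟨h1, h2⟩ := hpert k x (interior_subset hx)
      have := le_legendre h1 hy
      simp only [Pi.add_apply]
      linarith [(abs_le.1 h2).2]
    have hineq : ∀ k, 0 ≤ ∫ x, (legendre Y (fun y => ψ y + τ k * h y) x - φ x) / τ k ∂μ +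
        ∫ y, h y ∂ν := by
      intro k
      have hfeas : IsDualFeasible μ ν (fun x y => 1 / 2 * ‖x + y‖ ^ 2)
          (fun x => legendre Y (fun y => ψ y + τ k * h y) x + 1 / 2 * ‖x‖ ^ 2)
          (fun y => β y + τ k * h y) := by
        refine ⟨(hφki k).add (hμ2.const_mul _), hαβ.integrable_right.add (hhi.const_mul _),
          _, hint, Y, hYae, fun x hx y hy => ?_⟩
        have h1 := le_legendre (hpert k x (interior_subset hx)).1 hy
        simp only [hψ] at h1
        rw [hexp]
        linarith
      have h1 := hmin _ _ hfeas
      rw [integral_add (hφki k) (hμ2.const_mul _),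
        integral_add hαβ.integrable_right (hhi.const_mul _), integral_const_mul (τ k)] at h1
      have h2 : ∫ x, φ x ∂μ ≤ ∫ x, b x ∂μ := by
        refine integral_mono_ae hφi hbi ?_
        filter_upwards [hle] with x hx using legendre_le hY hx
      have h3 : ∫ x, b x ∂μ = ∫ x, α x ∂μ - ∫ x, 1 / 2 * ‖x‖ ^ 2 ∂μ :=
        integral_sub hαβ.integrable_left (hμ2.const_mul _)
      rw [integral_div, integral_sub (hφki k) hφi]
      have h4 : 0 ≤ (∫ x, legendre Y (fun y => ψ y + τ k * h y) x ∂μ - ∫ x, φ x ∂μ) +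
          τ k * ∫ y, h y ∂ν := by linarith
      have h5 := div_nonneg h4 (hτ0 k).le
      rwa [add_div, mul_div_cancel_left₀ _ (hτ0 k).ne'] at h5
    have hlim : Tendsto
        (fun k => ∫ x, (legendre Y (fun y => ψ y + τ k * h y) x - φ x) / τ k ∂μ) atTop
        (𝓝 (∫ x, -h (gradient φ x) ∂μ)) := by
      refine tendsto_integral_of_dominated_convergence (fun _ => ‖h‖)
        (fun k => (((hφki k).sub hφi).div_const _).aestronglyMeasurable) (integrable_const _)
        (fun k => ?_) ?_
      · filter_upwards [hint] with x hx
        have := (hpert k x (interior_subset hx)).2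
        rw [Real.norm_eq_abs, abs_div, abs_of_pos (hτ0 k)]
        exact (div_le_iff₀' (hτ0 k)).2 this
      · filter_upwards [hint, hdiff] with x hx hxd
        exact (tendsto_slope_legendre hY hM hx hxd h.continuous.continuousAt).comp hτlim
    have h6 := ge_of_tendsto' (hlim.add_const (∫ y, h y ∂ν)) hineq
    rw [integral_neg] at h6
    linarith
  have : IsProbabilityMeasure (μ.map (gradient φ)) :=
    Measure.isProbabilityMeasure_map hgm.aemeasurable
  refine ext_of_forall_integral_eq_of_IsFiniteMeasure fun h => ?_
  rw [integral_map hgm.aemeasurable h.continuous.aestronglyMeasurable]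
  refine le_antisymm (key h) ?_
  have := key (-h)
  simp only [BoundedContinuousFunction.coe_neg, Pi.neg_apply, integral_neg] at this
  linarith

end Brenier

/-! ### The Monge–Ampère equation -/

section MongeAmpere

variable {E : Type*} [NormedAddCommGroup E] [InnerProductSpace ℝ E] [FiniteDimensional ℝ E]
  [MeasurableSpace E] [BorelSpace E]

/-- An injective map that is differentiable with nonzero determinant along `s` pulls null sets back
to null subsets of `s`. -/
theorem quasiMeasurePreserving_of_det_ne_zero {T : E → E} {A : E → E →L[ℝ] E} {s : Set E}
    (hs : MeasurableSet s) (hT : Measurable T) (hA : ∀ x ∈ s, HasFDerivWithinAt T (A x) s x)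
    (hinj : InjOn T s) (hdet : ∀ x ∈ s, (A x).det ≠ 0) :
    Measure.QuasiMeasurePreserving T (volume.restrict s) volume := by
  refine ⟨hT, Measure.AbsolutelyContinuous.mk fun N hN hN0 => ?_⟩
  rw [Measure.map_apply hT hN, Measure.restrict_apply (hT hN)]
  set e := T ⁻¹' N ∩ s with he
  have hem : MeasurableSet e := (hT hN).inter hs
  have heA : ∀ x ∈ e, HasFDerivWithinAt T (A x) e x := fun x hx =>
    (hA x hx.2).mono inter_subset_right
  have h0 : ∫⁻ x in e, ENNReal.ofReal |(A x).det| = 0 := by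
    rw [lintegral_abs_det_fderiv_eq_addHaar_image volume hem heA (hinj.mono inter_subset_right)]
    exact measure_mono_null (image_subset_iff.2 inter_subset_left) hN0
  rw [lintegral_eq_zero_iff' (aemeasurable_ofReal_abs_det_fderivWithin volume hem heA)] at h0
  have hF : ∀ᵐ x ∂(volume.restrict e), False := by
    filter_upwards [h0, ae_restrict_mem hem] with x hx hxe
    have h1 := abs_pos.2 (hdet x hxe.2)
    have h2 : ENNReal.ofReal |(A x).det| = 0 := hx
    exact absurd (ENNReal.ofReal_eq_zero.1 h2) (not_le.2 h1)
  rw [← Measure.restrict_eq_zero]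
  simpa [ae_iff] using hF

/-- If `∇φ` pushes `f(x) dx` forward to `g(y) dy`, then `f(x) dx` does not charge the set where the
Hessian of `φ` is singular (its image is null), and on the set where it is nonsingular `∇φ` is
injective, so that the change of variables formula gives the Monge–Ampère equation. -/
theorem monge_ampere {f g : E → ℝ} (hf0 : ∀ x, 0 ≤ f x) (hg0 : ∀ x, 0 ≤ g x)
    (hf : AEMeasurable f volume) (hg : AEMeasurable g volume) {Ω : Set E} {φ : E → ℝ}
    (hΩ : IsOpen Ω) (hφ : ConvexOn ℝ Ω φ)
    (hmem : ∀ᵐ x ∂(volume.withDensity fun x => ENNReal.ofReal (f x)), x ∈ Ω)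
    (hpush : (volume.withDensity fun x => ENNReal.ofReal (f x)).map (gradient φ) =
      volume.withDensity fun x => ENNReal.ofReal (g x)) :
    (∃ S : Set E, (volume.withDensity fun x => ENNReal.ofReal (f x)) Sᶜ = 0 ∧
      InjOn (gradient φ) S) ∧
    ∀ᵐ x, x ∈ Ω → ∃ A : E →L[ℝ] E, DifferentiableAt ℝ φ x ∧
      HasFDerivWithinAt (gradient φ) A {z | DifferentiableAt ℝ φ z} x ∧
      g (gradient φ x) * A.det = f x := by
  set μ := volume.withDensity fun x => ENNReal.ofReal (f x) with hμ
  set ν := volume.withDensity fun x => ENNReal.ofReal (g x) with hν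
  set T := gradient φ with hTdef
  have hμv : μ ≪ volume := withDensity_absolutelyContinuous _ _
  have hνv : ν ≪ volume := withDensity_absolutelyContinuous _ _
  have hTm : Measurable T := measurable_gradient φ
  have halex := ae_hasSubgradientDerivAt hΩ hφ
  set G₀ : Set E := {x | x ∈ Ω ∧ DifferentiableAt ℝ φ x ∧
    ∃ A : E →L[ℝ] E, HasSubgradientDerivAt Ω φ A x} with hG₀
  have hG₀Ω : G₀ =ᵐ[volume] Ω := by
    filter_upwards [halex] with x hx
    exact propext ⟨fun h => h.1, fun h => ⟨h, hx h⟩⟩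
  obtain ⟨G, hGsub, hGm, hGae⟩ :=
    (hΩ.measurableSet.nullMeasurableSet.congr hG₀Ω.symm).exists_measurable_subset_ae_eq
  have hGΩ : ∀ᵐ x, x ∈ Ω → x ∈ G := by
    filter_upwards [hGae.trans hG₀Ω] with x hx hxΩ
    exact (eq_iff_iff.1 hx).2 hxΩ
  choose! A hA using fun x (hx : x ∈ G) => (hGsub hx).2.2
  have hAd : ∀ x ∈ G, HasFDerivWithinAt T (A x) {z | DifferentiableAt ℝ φ z} x := fun x hx =>
    (hA x hx).hasFDerivWithinAt hφ (hΩ.mem_nhds (hGsub hx).1)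
  have hAG : ∀ x ∈ G, HasFDerivWithinAt T (A x) G x := fun x hx =>
    (hAd x hx).mono fun z hz => (hGsub hz).2.1
  have hdet0 : ∀ x ∈ G, 0 ≤ (A x).det := fun x hx =>
    det_nonneg_of_inner_nonneg ((hA x hx).inner_nonneg hΩ hφ (hGsub hx).1 (hGsub hx).2.1)
  have hTinj : ∀ x ∈ G, (A x).det ≠ 0 → ∀ z ∈ G, T z = T x → z = x := by
    intro x hx hxd z hz hzx
    refine (hA x hx).eq_of_isApproxSubgradient hφ (hGsub hx).1 (hGsub hx).2.1 hxd (hGsub hz).1 ?_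
    have := isApproxSubgradient_gradient hφ (hGsub hz).1 (hGsub hz).2.1
    rwa [show gradient φ z = gradient φ x from hzx] at this
  -- The singular set.
  set Z := G ∩ {x | (A x).det = 0} with hZ
  have hμZ : μ Z = 0 := by
    have h1 : volume (T '' Z) = 0 := addHaar_image_eq_zero_of_det_fderivWithin_eq_zero _
      (fun x hx => (hAG x hx.1).mono inter_subset_left) fun x hx => hx.2
    have h2 : ν (toMeasurable volume (T '' Z)) = 0 := hνv (by rwa [measure_toMeasurable])
    rw [← hpush, Measure.map_apply hTm (measurableSet_toMeasurable _ _)] at h2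
    exact measure_mono_null (image_subset_iff.1 (subset_toMeasurable volume (T '' Z))) h2
  have hfZ : ∀ᵐ x, x ∈ Z → f x = 0 := by
    have h1 := (withDensity_apply_eq_zero' hf.ennreal_ofReal).1 hμZ
    filter_upwards [measure_eq_zero_iff_ae_notMem.1 h1] with x hx hxZ
    by_contra hfx
    refine hx ⟨?_, hxZ⟩
    have := lt_of_le_of_ne (hf0 x) (Ne.symm hfx)
    simpa using this
  have hμG : ∀ᵐ x ∂μ, x ∈ G := by
    filter_upwards [hmem, hμv.ae_le hGΩ] with x hx hxG using hxG hx
  -- The nonsingular set, replaced by a measurable subset of full measure.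
  have hMnull : NullMeasurableSet (G ∩ {x | (A x).det ≠ 0}) volume := by
    have h1 : AEMeasurable (fun x => (A x).det) (volume.restrict G) :=
      ContinuousLinearMap.continuous_det.measurable.comp_aemeasurable
        (aemeasurable_fderivWithin volume hGm hAG)
    have h2 : NullMeasurableSet {x | (A x).det ≠ 0} (volume.restrict G) :=
      h1.nullMeasurableSet_preimage (measurableSet_singleton (0 : ℝ)).compl
    rw [inter_comm]
    exact (nullMeasurableSet_restrict hGm.nullMeasurableSet).1 h2
  obtain ⟨M, hMsub, hMm, hMae⟩ := hMnull.exists_measurable_subset_ae_eq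
  have hMG : ∀ᵐ x, x ∈ G → (A x).det ≠ 0 → x ∈ M := by
    filter_upwards [hMae] with x hx hxG hxd
    exact (eq_iff_iff.1 hx).2 ⟨hxG, hxd⟩
  have hMd : ∀ x ∈ M, HasFDerivWithinAt T (A x) M x := fun x hx =>
    (hAG x (hMsub hx).1).mono fun z hz => (hMsub hz).1
  have hMinj : InjOn T M := fun x hx z hz hxz =>
    hTinj z (hMsub hz).1 (hMsub hz).2 x (hMsub hx).1 hxz
  refine ⟨⟨M, ?_, hMinj⟩, ?_⟩
  · change ∀ᵐ x ∂μ, x ∈ M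
    filter_upwards [hμG, hμv.ae_le hMG, measure_eq_zero_iff_ae_notMem.1 hμZ] with x h1 h2 h3
    exact h2 h1 fun h => h3 ⟨h1, h⟩
  have hqmp := quasiMeasurePreserving_of_det_ne_zero hMm hTm hMd hMinj fun x hx => (hMsub hx).2
  have hdens : (fun x => ENNReal.ofReal (f x)) =ᵐ[volume.restrict M]
      fun x => ENNReal.ofReal |(A x).det| * ENNReal.ofReal (g (T x)) := by
    refine ae_eq_of_forall_setLIntegral_eq_of_sigmaFinite₀ hf.ennreal_ofReal.restrict
      ((aemeasurable_ofReal_abs_det_fderivWithin volume hMm hMd).mul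
        (hg.comp_quasiMeasurePreserving hqmp).ennreal_ofReal) fun s hs _ => ?_
    rw [Measure.restrict_restrict hs]
    set e := s ∩ M with he
    have hem : MeasurableSet e := hs.inter hMm
    have heM : e ⊆ M := inter_subset_right
    have hed : ∀ x ∈ e, HasFDerivWithinAt T (A x) e x := fun x hx => (hMd x (heM hx)).mono heM
    have himg : MeasurableSet (T '' e) :=
      measurable_image_of_fderivWithin hem hed (hMinj.mono heM)
    rw [← lintegral_image_eq_lintegral_abs_det_fderiv_mul volume hem hed (hMinj.mono heM)
      (fun y => ENNReal.ofReal (g y)), ← withDensity_apply _ hem, ← withDensity_apply _ himg,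
      ← hμ, ← hν, ← hpush, Measure.map_apply hTm himg]
    refine measure_congr ?_
    filter_upwards [hμG] with x hx
    refine propext ⟨fun h => mem_image_of_mem T h, ?_⟩
    rintro ⟨z, hz, hzx⟩
    rwa [hTinj z (hMsub (heM hz)).1 (hMsub (heM hz)).2 x hx hzx.symm]
  rw [EventuallyEq, ae_restrict_iff' hMm] at hdens
  filter_upwards [hGΩ, hfZ, hMG, hdens] with x h1 h2 h3 h4 hxΩ
  have hxG := h1 hxΩ
  refine ⟨A x, (hGsub hxG).2.1, hAd x hxG, ?_⟩
  by_cases hd : (A x).det = 0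
  · rw [hd, mul_zero, h2 ⟨hxG, hd⟩]
  · have h5 := h4 (h3 hxG hd)
    rw [abs_of_nonneg (hdet0 x hxG), ← ENNReal.ofReal_mul (hdet0 x hxG),
      ENNReal.ofReal_eq_ofReal_iff (hf0 x) (mul_nonneg (hdet0 x hxG) (hg0 _))] at h5
    rw [h5, mul_comm]

end MongeAmpere

/-! ### Optimality and uniqueness -/

section Optimality

theorem IsDensity.isProbabilityMeasure {n : ℕ} {f : Euc n → ℝ} (hf : IsDensity f) :
    IsProbabilityMeasure (densityMeasure f) := by
  refine ⟨?_⟩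
  rw [densityMeasure, withDensity_apply _ MeasurableSet.univ, Measure.restrict_univ,
    ← ofReal_integral_eq_lintegral_ofReal hf.integrable (Eventually.of_forall hf.nonneg),
    hf.integral_eq_one, ENNReal.ofReal_one]

theorem IsDensity.integrable_sq {n : ℕ} {f : Euc n → ℝ} (hf : IsDensity f) :
    Integrable (fun x => ‖x‖ ^ 2) (densityMeasure f) := by
  rw [densityMeasure, integrable_withDensity_iff_integrable_smul₀'
    hf.integrable.aestronglyMeasurable.aemeasurable.ennreal_ofReal
    (Eventually.of_forall fun x => ENNReal.ofReal_lt_top)]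
  refine hf.secondMoment.congr (Eventually.of_forall fun x => ?_)
  simp only [ENNReal.toReal_ofReal (hf.nonneg x), smul_eq_mul]
  ring

variable {n : ℕ} {f g : Euc n → ℝ} {π : Measure (Euc n × Euc n)}

theorem IsPlan.integrable_fst (hπ : IsPlan f g π) {u : Euc n → ℝ}
    (hu : Integrable u (densityMeasure f)) : Integrable (fun p => u p.1) π := by
  rw [← hπ.fst_eq] at hu
  exact hu.comp_measurable measurable_fst

theorem IsPlan.integrable_snd (hπ : IsPlan f g π) {v : Euc n → ℝ}
    (hv : Integrable v (densityMeasure g)) : Integrable (fun p => v p.2) π := by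
  rw [← hπ.snd_eq] at hv
  exact hv.comp_measurable measurable_snd

theorem IsPlan.integral_fst (hπ : IsPlan f g π) {u : Euc n → ℝ}
    (hu : Integrable u (densityMeasure f)) : ∫ p, u p.1 ∂π = ∫ x, u x ∂(densityMeasure f) := by
  rw [← hπ.fst_eq] at hu ⊢
  exact (integral_map measurable_fst.aemeasurable hu.aestronglyMeasurable).symm

theorem IsPlan.integral_snd (hπ : IsPlan f g π) {v : Euc n → ℝ}
    (hv : Integrable v (densityMeasure g)) : ∫ p, v p.2 ∂π = ∫ y, v y ∂(densityMeasure g) := by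
  rw [← hπ.snd_eq] at hv ⊢
  exact (integral_map measurable_snd.aemeasurable hv.aestronglyMeasurable).symm

theorem IsPlan.ae_fst (hπ : IsPlan f g π) {P : Euc n → Prop}
    (h : ∀ᵐ x ∂(densityMeasure f), P x) : ∀ᵐ p ∂π, P p.1 := by
  rw [← hπ.fst_eq] at h
  exact ae_of_ae_map measurable_fst.aemeasurable h

theorem IsPlan.ae_snd (hπ : IsPlan f g π) {P : Euc n → Prop}
    (h : ∀ᵐ y ∂(densityMeasure g), P y) : ∀ᵐ p ∂π, P p.2 := by
  rw [← hπ.snd_eq] at h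
  exact ae_of_ae_map measurable_snd.aemeasurable h

theorem IsPlan.integrable_inner (hπ : IsPlan f g π) (hf : IsDensity f) (hg : IsDensity g) :
    Integrable (fun p => ⟪p.1, p.2⟫) π := by
  refine Integrable.mono' ((hπ.integrable_fst hf.integrable_sq).add
    (hπ.integrable_snd hg.integrable_sq)) (by fun_prop) (Eventually.of_forall fun p => ?_)
  refine (norm_inner_le_norm p.1 p.2).trans ?_
  simp only [Pi.add_apply]
  nlinarith [sq_nonneg (‖p.1‖ - ‖p.2‖)]

/-- As the second moments are fixed, minimizing the cost amounts to maximizing `∫ ⟪x, y⟫ dπ`. -/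
theorem IsPlan.cost_eq (hπ : IsPlan f g π) (hf : IsDensity f) (hg : IsDensity g) :
    cost π = ENNReal.ofReal (1 / 2 * ∫ x, ‖x‖ ^ 2 ∂(densityMeasure f) +
      1 / 2 * ∫ y, ‖y‖ ^ 2 ∂(densityMeasure g) - ∫ p, ⟪p.1, p.2⟫ ∂π) ∧
    0 ≤ 1 / 2 * ∫ x, ‖x‖ ^ 2 ∂(densityMeasure f) +
      1 / 2 * ∫ y, ‖y‖ ^ 2 ∂(densityMeasure g) - ∫ p, ⟪p.1, p.2⟫ ∂π := by
  have h1 := (hπ.integrable_fst hf.integrable_sq).const_mul (1 / 2)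
  have h2 := (hπ.integrable_snd hg.integrable_sq).const_mul (1 / 2)
  have h12 : Integrable (fun p : Euc n × Euc n => 1 / 2 * ‖p.1‖ ^ 2 + 1 / 2 * ‖p.2‖ ^ 2) π :=
    h1.add h2
  have h3 := hπ.integrable_inner hf hg
  have heq : ∀ p : Euc n × Euc n, 1 / 2 * ‖p.1 - p.2‖ ^ 2 =
      1 / 2 * ‖p.1‖ ^ 2 + 1 / 2 * ‖p.2‖ ^ 2 - ⟪p.1, p.2⟫ := by
    intro p
    rw [norm_sub_sq_real]
    ring
  have hint : ∫ p, (1 / 2 * ‖p.1‖ ^ 2 + 1 / 2 * ‖p.2‖ ^ 2 - ⟪p.1, p.2⟫) ∂π =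
      1 / 2 * ∫ x, ‖x‖ ^ 2 ∂(densityMeasure f) +
      1 / 2 * ∫ y, ‖y‖ ^ 2 ∂(densityMeasure g) - ∫ p, ⟪p.1, p.2⟫ ∂π := by
    rw [integral_sub h12 h3, integral_add h1 h2, integral_const_mul, integral_const_mul,
      hπ.integral_fst hf.integrable_sq, hπ.integral_snd hg.integrable_sq]
  have hnn : ∀ p : Euc n × Euc n,
      0 ≤ 1 / 2 * ‖p.1‖ ^ 2 + 1 / 2 * ‖p.2‖ ^ 2 - ⟪p.1, p.2⟫ := fun p => by
    rw [← heq]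
    positivity
  have hdi : Integrable (fun p : Euc n × Euc n =>
      1 / 2 * ‖p.1‖ ^ 2 + 1 / 2 * ‖p.2‖ ^ 2 - ⟪p.1, p.2⟫) π := h12.sub h3
  have hdi : Integrable (fun p : Euc n × Euc n =>
      1 / 2 * ‖p.1‖ ^ 2 + 1 / 2 * ‖p.2‖ ^ 2 - ⟪p.1, p.2⟫) π := h12.sub h3
  rw [← hint]
  refine ⟨?_, integral_nonneg hnn⟩
  rw [ofReal_integral_eq_lintegral_ofReal hdi (Eventually.of_forall hnn), cost]
  simp only [heq]

theorem IsPlan.integral_inner_le (hπ : IsPlan f g π) (hf : IsDensity f) (hg : IsDensity g)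
    {u v : Euc n → ℝ} (hu : Integrable u (densityMeasure f))
    (hv : Integrable v (densityMeasure g)) (hle : ∀ᵐ p ∂π, ⟪p.1, p.2⟫ ≤ u p.1 + v p.2) :
    ∫ p, ⟪p.1, p.2⟫ ∂π ≤ ∫ x, u x ∂(densityMeasure f) + ∫ y, v y ∂(densityMeasure g) := by
  rw [← hπ.integral_fst hu, ← hπ.integral_snd hv,
    ← integral_add (hπ.integrable_fst hu) (hπ.integrable_snd hv)]
  exact integral_mono_ae (hπ.integrable_inner hf hg)
    ((hπ.integrable_fst hu).add (hπ.integrable_snd hv)) hle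

/-- Complementary slackness: a plan that attains the dual value is concentrated on the set of
equality in the dual constraint. -/
theorem IsPlan.ae_inner_eq (hπ : IsPlan f g π) (hf : IsDensity f) (hg : IsDensity g)
    {u v : Euc n → ℝ} (hu : Integrable u (densityMeasure f))
    (hv : Integrable v (densityMeasure g)) (hle : ∀ᵐ p ∂π, ⟪p.1, p.2⟫ ≤ u p.1 + v p.2)
    (hge : ∫ x, u x ∂(densityMeasure f) + ∫ y, v y ∂(densityMeasure g) ≤ ∫ p, ⟪p.1, p.2⟫ ∂π) :
    ∀ᵐ p ∂π, ⟪p.1, p.2⟫ = u p.1 + v p.2 := by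
  have huv : Integrable (fun p : Euc n × Euc n => u p.1 + v p.2) π :=
    (hπ.integrable_fst hu).add (hπ.integrable_snd hv)
  rw [← hπ.integral_fst hu, ← hπ.integral_snd hv,
    ← integral_add (hπ.integrable_fst hu) (hπ.integrable_snd hv)] at hge
  exact (integral_eq_iff_of_ae_le (hπ.integrable_inner hf hg) huv hle).1
    (le_antisymm (integral_mono_ae (hπ.integrable_inner hf hg) huv hle) hge)

theorem isPlan_map_graph {T : Euc n → Euc n} (hT : Measurable T)
    (hpush : (densityMeasure f).map T = densityMeasure g) :
    IsPlan f g ((densityMeasure f).map fun x => (x, T x)) := by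
  have hm : Measurable fun x => (x, T x) := measurable_id.prodMk hT
  refine ⟨?_, ?_⟩
  · rw [Measure.map_map measurable_fst hm]
    exact Measure.map_id
  · rw [Measure.map_map measurable_snd hm]
    exact hpush

end Optimality

end OptimalTransport

theorem theorem2 (n : ℕ) (f g : OptimalTransport.Euc n → ℝ)
    (hf : OptimalTransport.IsDensity f) (hg : OptimalTransport.IsDensity g) :
    ∃ ν₀ : Measure (OptimalTransport.Euc n × OptimalTransport.Euc n),
      -- `ν₀` is the unique optimal plan
      OptimalTransport.IsOptimalPlan f g ν₀ ∧
      (∀ ν, OptimalTransport.IsOptimalPlan f g ν → ν = ν₀) ∧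
      ∃ (Ω : Set (OptimalTransport.Euc n)) (φ : OptimalTransport.Euc n → ℝ),
        -- a convex potential on an open convex set that carries `f(x) dx`
        IsOpen Ω ∧ OptimalTransport.densityMeasure f Ωᶜ = 0 ∧ ConvexOn ℝ Ω φ ∧
        (∀ᵐ x, x ∈ Ω → DifferentiableAt ℝ φ x) ∧
        -- `ν₀` is concentrated on the graph of `∇φ`, which pushes `f(x) dx` to `g(y) dy`
        ν₀ = (OptimalTransport.densityMeasure f).map (fun x => (x, gradient φ x)) ∧
        (OptimalTransport.densityMeasure f).map (gradient φ) =
          OptimalTransport.densityMeasure g ∧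
        -- the map is one-to-one, up to a null set
        (∃ S : Set (OptimalTransport.Euc n), OptimalTransport.densityMeasure f Sᶜ = 0 ∧
          Set.InjOn (gradient φ) S) ∧
        -- the Monge-Ampère equation, almost everywhere on `Ω`
        (∀ᵐ x, x ∈ Ω → ∃ A : OptimalTransport.Euc n →L[ℝ] OptimalTransport.Euc n,
          OptimalTransport.HasHessianAt φ A x ∧ g (gradient φ x) * A.det = f x) := by
  open OptimalTransport Filter Set in
  have hμp := hf.isProbabilityMeasure
  have hνp := hg.isProbabilityMeasure
  have hμv : densityMeasure f ≪ volume := withDensity_absolutelyContinuous _ _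
  have hνv : densityMeasure g ≪ volume := withDensity_absolutelyContinuous _ _
  obtain ⟨Y, ψ, hYae, hψi, hint, hφi, hpush⟩ :=
    exists_potential hμv hf.integrable_sq hg.integrable_sq
  set φ := legendre Y ψ with hφ
  set Ω := interior (legendreDom Y ψ) with hΩ
  have hY : Y.Nonempty := nonempty_of_mem hYae
  have hΩo : IsOpen Ω := isOpen_interior
  have hconv : ConvexOn ℝ Ω φ :=
    (convexOn_legendre hY).subset interior_subset (convexOn_legendre hY).1.interior
  have hdiff := ae_differentiableAt_of_convexOn hΩo hconv
  have hdiffμ : ∀ᵐ x ∂(densityMeasure f), DifferentiableAt ℝ φ x := by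
    filter_upwards [hint, hμv.ae_le hdiff] with x hx hxd using hxd hx
  have hTm : Measurable (gradient φ) := measurable_gradient φ
  have hΩne : Ω.Nonempty := nonempty_of_mem hint
  -- The conjugate potential is integrable, being at most `ψ` on `Y`.
  obtain ⟨hint', hφsi⟩ := integrable_legendre (Y := Ω) (ψ := φ) hνv
    (integrable_norm_of_sq hg.integrable_sq) hΩne hψi (by
      filter_upwards [hYae] with y hy x hx
      have := le_legendre (interior_subset hx) hy
      rw [real_inner_comm]
      linarith)
  have hyoung : ∀ {π}, IsPlan f g π →
      ∀ᵐ p ∂π, inner ℝ p.1 p.2 ≤ φ p.1 + legendre Ω φ p.2 := by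
    intro π hπ
    filter_upwards [hπ.ae_fst hint, hπ.ae_snd hint'] with p h1 h2
    have := le_legendre (interior_subset h2) h1
    rw [real_inner_comm]
    linarith
  set ν₀ := (densityMeasure f).map (fun x => (x, gradient φ x)) with hν₀
  have hplan : IsPlan f g ν₀ := isPlan_map_graph hTm hpush
  have hgm : Measurable fun x => (x, gradient φ x) := measurable_id.prodMk hTm
  have hφsT : Integrable (fun x => legendre Ω φ (gradient φ x)) (densityMeasure f) :=
    (hplan.integrable_snd hφsi).comp_measurable hgm
  have hφsT : Integrable (fun x => legendre Ω φ (gradient φ x)) (densityMeasure f) :=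
    (hplan.integrable_snd hφsi).comp_measurable hgm
  have hval : ∫ p, inner ℝ p.1 p.2 ∂ν₀ =
      ∫ x, φ x ∂(densityMeasure f) + ∫ y, legendre Ω φ y ∂(densityMeasure g) := by
    rw [← hplan.integral_snd hφsi, hν₀, integral_map hgm.aemeasurable
      (hplan.integrable_inner hf hg).aestronglyMeasurable, integral_map hgm.aemeasurable
      (hplan.integrable_snd hφsi).aestronglyMeasurable, ← integral_add hφi hφsT]
    refine integral_congr_ae ?_
    filter_upwards [hint, hdiffμ] with x hx hxd using legendre_gradient hconv hx hxd
  have hopt : IsOptimalPlan f g ν₀ := by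
    refine ⟨hplan, fun π hπ => ?_⟩
    rw [(hplan.cost_eq hf hg).1, (hπ.cost_eq hf hg).1, hval]
    refine ENNReal.ofReal_le_ofReal ?_
    linarith [hπ.integral_inner_le hf hg hφi hφsi (hyoung hπ)]
  obtain ⟨hinj, hMA⟩ := monge_ampere hf.nonneg hg.nonneg
    hf.integrable.aestronglyMeasurable.aemeasurable
    hg.integrable.aestronglyMeasurable.aemeasurable hΩo hconv hint hpush
  refine ⟨ν₀, hopt, fun π hπo => ?_, Ω, φ, hΩo, hint, hconv, hdiff, rfl, hpush, hinj, ?_⟩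
  · have hπ := hπo.isPlan
    have hcost := hπo.cost_le ν₀ hplan
    rw [(hplan.cost_eq hf hg).1, (hπ.cost_eq hf hg).1,
      ENNReal.ofReal_le_ofReal_iff (hplan.cost_eq hf hg).2, hval] at hcost
    have heq := hπ.ae_inner_eq hf hg hφi hφsi (hyoung hπ) (by linarith)
    have hgraph : ∀ᵐ p ∂π, p = (p.1, gradient φ p.1) := by
      filter_upwards [heq, hπ.ae_fst hint, hπ.ae_fst hdiffμ, hπ.ae_snd hint'] with p h1 h2 h3 h4
      exact Prod.ext rfl (eq_gradient_of_inner_eq hconv hΩo h2 h3 (interior_subset h4) h1)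
    rw [hν₀, ← hπ.fst_eq, Measure.map_map hgm measurable_fst]
    conv_lhs => rw [← Measure.map_id (μ := π)]
    exact Measure.map_congr hgraph
  · filter_upwards [hMA] with x hx hxΩ
    obtain ⟨A, h1, h2, h3⟩ := hx hxΩ
    exact ⟨A, ⟨h1, h2⟩, h3⟩
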